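/- Let $C\ge 1$, $K\ge 2$ and rates $0<r_1<\dots<r_K$ be given. For success probabilities $\theta=(\theta_{ck})\in[0,1]^{C\times K}$ put $\mu_{ck}=r_k\theta_{ck}$ (the throughput of channel $c$ at rate $k$). Assume (Scenario 2) that for every channel $c$: $\theta_{c1}\ge\dots\ge\theta_{cK}$, and $k\mapsto\mu_{ck}$ is strictly unimodal, i.e. for some $k_c^\star$ it is strictly increasing on $\{1,\dots,k_c^\star\}$ and strictly decreasing on $\{k_c^\star,\dots,K\}$. Assume also that the best pair $(c^\star,k^\star)$ is unique, and let $\mu^\star=\mu_{c^\star k^\star}$. When the pair $(c,k)$ is used for the $i$-th time the reward is $r_kX_{ck}(i)$, where for each $(c,k)$ the variables $X_{ck}(1),X_{ck}(2),\dots$ are i.i.d. Bernoulli with mean $\theta_{ck}$. Let $t_{ck}(n)$ be the number of times $(c,k)$ is selected among the first $n$ transmissions, and $\hat\mu_{ck}(n)=\frac1{t_{ck}(n)}\sum_{i\le t_{ck}(n)}r_kX_{ck}(i)$. Let $I(p,q)=p\log\frac pq+(1-p)\log\frac{1-p}{1-q}$ be the Bernoulli Kullback–Leibler divergence, with the usual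 conventions, and $I(p,q)=\infty$ if $q>1$. Let $q_{ck}(n)$ and $\underline q_{ck}(n)$ be the maximum and the minimum of $$\{q\in[0,r_k]:\ t_{ck}(n)\,I(\hat\mu_{ck}(n)/r_k,\,q/r_k)\le \log n+3\log\log n\}$$ (with the right-hand side replaced by $0$ when $n=2$, where it is negative). The CRS-T algorithm first selects each pair once, in lexicographic order ($CK$ transmissions). For $n\ge CK$, let $l_c(n)\in\arg\max_k\hat\mu_{ck}(n)$ be the leader of channel $c$, and let $\mathcal U(n)$ be the set of channels $c$ that fail the test $\underline q_{c\,l_c(n)}(n)\ge\max_{k:|k-l_c(n)|=1}q_{ck}(n)$. The $(n+1)$-th transmission uses: if $\mathcal U(n)\ne\emptyset$, some channel $c\in\mathcal U(n)$ and a rate $k\in\arg\min_{k':|k'-l_c(n)|\le1}t_{ck'}(n)$; if $\mathcal U(n)=\emptyset$, a pair $(c,k)$ maximizing $q_{ck}(n)\mathbf 1\{k=l_c(n)\}$. All ambiguous decisions are made arbitrarily. Let $\Delta=\min_{c}\min_{|k-k'|=1}|\mu_{ck}-\mu_{ck'}|$, $\tilde\mu_c=\frac12\big(\mu_{ck_c^\star}+\max_{|k-k_c^\star|=1}\mu_{ck}\big)$,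 and $$\tau_c=\min\Big(\min_{k:|k-k_c^\star|\le1}I(\theta_{ck},\tilde\mu_c/r_k),\ I(\theta_{ck_c^\star},\mu^\star/r_{k_c^\star})\Big)\quad(c\ne c^\star),$$ $$\tau_{c^\star}=\min_{k:|k-k^\star|\le1}I(\theta_{c^\star k},\tilde\mu_{c^\star}/r_k),\qquad c^{\text{CRS-T}}(\theta)=\sum_{c=1}^C\tau_c^{-1}\sum_{k:|k-k_c^\star|\le1}(\mu^\star-\mu_{ck}).$$ Then for every $\epsilon>0$ there is a constant $\Gamma_\epsilon>0$, depending only on $\epsilon$, $C$, $K$ and $(r_1,\dots,r_K)$, and not on $\theta$, such that for every $\theta$ as above $c^{\text{CRS-T}}(\theta)$ is finite and, for all integers $T\ge3$, the regret $R(T)=\mu^\star T-\sum_{c,k}\mu_{ck}\,\mathbb E[t_{ck}(T)]$ of CRS-T satisfies $$R(T)\le(1+\epsilon)\,c^{\text{CRS-T}}(\theta)\log T+\Gamma_\epsilon\big(\Delta^{-2}+\log\log T\big).$$ (The sum defining $c^{\text{CRS-T}}(\theta)$ has, for each channel, only the terms of its best rate and of the at most two neighbouring rates, so at most $3C$ terms,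 whatever the number of rates.) -/

import Mathlib

open MeasureTheory ProbabilityTheory
open scoped ENNReal

noncomputable section

namespace CRS

/-! ### The model -/

/-- `μ_{ck} = r_k θ_{ck}`: throughput of the (channel, rate) pair `(c, k)`. -/
def thr {C K : ℕ} (r : Fin K → ℝ) (θ : Fin C → Fin K → ℝ) (c : Fin C) (k : Fin K) : ℝ :=
  r k * θ c k

/-- `𝒯`: nonincreasing vectors of success probabilities. -/
def monotoneSet (K : ℕ) : Set (Fin K → ℝ) :=
  {η | (∀ k, η k ∈ Set.Icc (0 : ℝ) 1) ∧ Antitone η}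

/-- `𝒰`: vectors of success probabilities for which the throughput `k ↦ r_k η_k` is (strictly)
unimodal. -/
def unimodalSet {K : ℕ} (r : Fin K → ℝ) : Set (Fin K → ℝ) :=
  {η | (∀ k, η k ∈ Set.Icc (0 : ℝ) 1) ∧
    ∃ k₁ : Fin K, StrictMonoOn (fun k => r k * η k) (Set.Iic k₁) ∧
      StrictAntiOn (fun k => r k * η k) (Set.Ici k₁)}

/-- `k` is the unique best rate on channel `c`. -/
def IsBestRate {C K : ℕ} (r : Fin K → ℝ) (θ : Fin C → Fin K → ℝ) (c : Fin C) (k : Fin K) : Prop :=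
  ∀ k', k' ≠ k → thr r θ c k' < thr r θ c k

/-- `(c, k)` is the unique best (channel, rate) pair. -/
def IsBestPair {C K : ℕ} (r : Fin K → ℝ) (θ : Fin C → Fin K → ℝ) (c : Fin C) (k : Fin K) : Prop :=
  ∀ c' k', (c', k') ≠ (c, k) → thr r θ c' k' < thr r θ c k

/-- `|k - k'|` as an integer. -/
def rateDist {K : ℕ} (k k' : Fin K) : ℤ := |((k : ℕ) : ℤ) - ((k' : ℕ) : ℤ)|

/-- `X c k i` is the outcome (`1` success, `0` failure) of the transmission made when the pair
`(c, k)` is used for the `(i + 1)`-th time. For each pair the outcomes are i.i.d. Bernoulli with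
mean `θ c k`. -/
structure IsOutcomeModel {C K : ℕ} {Ω : Type*} [MeasurableSpace Ω] (P : Measure Ω)
    (θ : Fin C → Fin K → ℝ) (X : Fin C → Fin K → ℕ → Ω → ℝ) : Prop where
  measurable : ∀ c k i, Measurable (X c k i)
  binary : ∀ c k i ω, X c k i ω = 0 ∨ X c k i ω = 1
  mean : ∀ c k i, ∫ ω, X c k i ω ∂P = θ c k
  indep : ∀ c k, iIndepFun (fun i => X c k i) P

/-! ### Bernoulli Kullback-Leibler divergence -/

/-- `I(p, q) = p log (p / q) + (1 - p) log ((1 - p) / (1 - q))` for `p, q ∈ [0, 1]`, with the usual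
conventions `0 log 0 = 0`, `0 log (0 / 0) = 0`, `a log (a / 0) = ∞` for `a > 0`; moreover
`I(p, q) = ∞` when `q` is not in `[0, 1]`. -/
def kl (p q : ℝ) : ℝ≥0∞ :=
  open Classical in
  if 0 ≤ q ∧ q ≤ 1 ∧ (q = 0 → p = 0) ∧ (q = 1 → p = 1) then
    ENNReal.ofReal (p * Real.log (p / q) + (1 - p) * Real.log ((1 - p) / (1 - q)))
  else ⊤

/-! ### Statistics of a trajectory

A trajectory is given by the outcomes `x c k i` and by the selected pairs: `a n` is the pair
selected for the `(n + 1)`-th transmission. -/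

/-- `t_{ck}(n)`: number of times `(c, k)` is selected in the first `n` transmissions. -/
def pulls {C K : ℕ} (a : ℕ → Fin C × Fin K) (n : ℕ) (c : Fin C) (k : Fin K) : ℕ :=
  ((Finset.range n).filter (fun m => a m = (c, k))).card

/-- Empirical throughput of `(c, k)` after `n` transmissions. -/
def empThr {C K : ℕ} (r : Fin K → ℝ) (x : Fin C → Fin K → ℕ → ℝ) (a : ℕ → Fin C × Fin K)
    (n : ℕ) (c : Fin C) (k : Fin K) : ℝ :=
  (∑ i ∈ Finset.range (pulls a n c k), r k * x c k i) / (pulls a n c k : ℝ)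

/-- The values `q ∈ [0, r_k]` such that
`t_{ck}(n) I(empirical throughput / r_k, q / r_k) ≤ log n + 3 log log n`.
The right-hand side is nonnegative for `n = 1` and for `n ≥ 3`; for `n = 2` it is replaced by its
positive part `0`, so that the set is never empty once `(c, k)` has been used. -/
def confSet {C K : ℕ} (r : Fin K → ℝ) (x : Fin C → Fin K → ℕ → ℝ) (a : ℕ → Fin C × Fin K)
    (n : ℕ) (c : Fin C) (k : Fin K) : Set ℝ :=
  {q | q ∈ Set.Icc 0 (r k) ∧
    (pulls a n c k : ℝ≥0∞) * kl (empThr r x a n c k / r k) (q / r k) ≤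
      ENNReal.ofReal (Real.log n + 3 * Real.log (Real.log n))}

/-- The KL-UCB index (upper confidence bound). -/
def ucb {C K : ℕ} (r : Fin K → ℝ) (x : Fin C → Fin K → ℕ → ℝ) (a : ℕ → Fin C × Fin K)
    (n : ℕ) (c : Fin C) (k : Fin K) : ℝ :=
  sSup (confSet r x a n c k)

/-- The lower confidence bound. -/
def lcb {C K : ℕ} (r : Fin K → ℝ) (x : Fin C → Fin K → ℕ → ℝ) (a : ℕ → Fin C × Fin K)
    (n : ℕ) (c : Fin C) (k : Fin K) : ℝ :=
  sInf (confSet r x a n c k)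

/-! ### The algorithm -/

/-- `k` is a leader of channel `c` after `n` transmissions: it maximizes the empirical
throughput on that channel. -/
def IsLeader {C K : ℕ} (r : Fin K → ℝ) (x : Fin C → Fin K → ℕ → ℝ) (a : ℕ → Fin C × Fin K)
    (n : ℕ) (c : Fin C) (k : Fin K) : Prop :=
  ∀ k', empThr r x a n c k' ≤ empThr r x a n c k

/-- The test `U_c(n) = 1`, for the leader `l`: the lower confidence bound of the leader is at
least the upper confidence bound of each of its neighbours. -/
def TestPassed {C K : ℕ} (r : Fin K → ℝ) (x : Fin C → Fin K → ℕ → ℝ) (a : ℕ → Fin C × Fin K)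
    (n : ℕ) (c : Fin C) (l : Fin K) : Prop :=
  ∀ k, rateDist k l = 1 → ucb r x a n c k ≤ lcb r x a n c l

/-- The index `b_{ck}(n)`, for the leader `l` of channel `c`. -/
def leaderIndex {C K : ℕ} (r : Fin K → ℝ) (x : Fin C → Fin K → ℕ → ℝ) (a : ℕ → Fin C × Fin K)
    (n : ℕ) (c : Fin C) (l k : Fin K) : ℝ :=
  if k = l then ucb r x a n c k else 0

/-- The selections `a` are those of CRS-T when the outcomes are `x`. Every ambiguous decision
(choice of the leaders, of the channel failing its test, of a minimizer, of a maximizer) is free. -/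
structure IsCRST {C K : ℕ} (r : Fin K → ℝ) (x : Fin C → Fin K → ℕ → ℝ)
    (a : ℕ → Fin C × Fin K) : Prop where
  /-- Initialization: each pair is selected once, in lexicographic order. -/
  init : ∀ n, n < C * K → ((a n).1 : ℕ) = n / K ∧ ((a n).2 : ℕ) = n % K
  step : ∀ n, C * K ≤ n → ∃ l : Fin C → Fin K, (∀ c, IsLeader r x a n c (l c)) ∧
    ((∃ c, ¬ TestPassed r x a n c (l c)) →
      ¬ TestPassed r x a n (a n).1 (l (a n).1) ∧
      rateDist (a n).2 (l (a n).1) ≤ 1 ∧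
      ∀ k, rateDist k (l (a n).1) ≤ 1 →
        pulls a n (a n).1 (a n).2 ≤ pulls a n (a n).1 k) ∧
    ((∀ c, TestPassed r x a n c (l c)) →
      ∀ c k, leaderIndex r x a n c (l c) k ≤
        leaderIndex r x a n (a n).1 (l (a n).1) (a n).2)

/-! ### Regret and the constants of the bound -/

/-- Regret after `T` transmissions, where `(cs, ks)` is the best pair:
`μ_{cs ks} T - ∑_{c,k} μ_{ck} E[t_{ck}(T)]`. -/
def regret {C K : ℕ} {Ω : Type*} [MeasurableSpace Ω] (P : Measure Ω) (r : Fin K → ℝ)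
    (θ : Fin C → Fin K → ℝ) (cs : Fin C) (ks : Fin K) (sel : ℕ → Ω → Fin C × Fin K) (T : ℕ) : ℝ :=
  thr r θ cs ks * T -
    ∑ c, ∑ k, thr r θ c k * ∫ ω, (pulls (fun n => sel n ω) T c k : ℝ) ∂P

/-- `Δ`: smallest separation between neighbouring rates on a channel. -/
def minGap {C K : ℕ} (r : Fin K → ℝ) (θ : Fin C → Fin K → ℝ) : ℝ :=
  sInf {d | ∃ c k k', rateDist k' k = 1 ∧ d = |thr r θ c k - thr r θ c k'|}

/-- `μ̃_c`: midpoint of the best throughput on channel `c` (attained at the rate `kc`) and of the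
largest throughput of a neighbour of `kc`. -/
def midThr {C K : ℕ} (r : Fin K → ℝ) (θ : Fin C → Fin K → ℝ) (c : Fin C) (kc : Fin K) : ℝ :=
  (thr r θ c kc + sSup {m | ∃ k, rateDist k kc = 1 ∧ m = thr r θ c k}) / 2

/-- `τ_c`, where `(cs, ks)` is the best pair and `kc` the best rate on channel `c`. The comparison
with the best throughput only concerns the channels other than `cs` (for `cs` the divergence would
be `I(θ_{cs ks}, θ_{cs ks}) = 0`). -/
def tau {C K : ℕ} (r : Fin K → ℝ) (θ : Fin C → Fin K → ℝ) (cs : Fin C) (ks : Fin K)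
    (c : Fin C) (kc : Fin K) : ℝ≥0∞ :=
  min (⨅ (k : Fin K) (_ : rateDist k kc ≤ 1), kl (θ c k) (midThr r θ c kc / r k))
    (⨅ (_ : c ≠ cs), kl (θ c kc) (thr r θ cs ks / r kc))

/-- The constant `c^{CRS-T}(θ)`, where `(cs, ks)` is the best pair and `kb c` the best rate on
channel `c`. -/
def crsConst {C K : ℕ} (r : Fin K → ℝ) (θ : Fin C → Fin K → ℝ) (cs : Fin C) (ks : Fin K)
    (kb : Fin C → Fin K) : ℝ≥0∞ :=
  ∑ c, (tau r θ cs ks c (kb c))⁻¹ *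
    ∑ k ∈ Finset.univ.filter (fun k => rateDist k (kb c) ≤ 1),
      ENNReal.ofReal (thr r θ cs ks - thr r θ c k)

end CRS

end

/-!
The proof bounds the regret through deviations of the averages of each pair taken on its own, so the
way in which the algorithm resolves its free choices plays no role. Since the `s`-th selection of a
pair happens only once, a selection of `(c, k)` can be charged to the value `s` of its number of
previous selections, and it is enough to bound, for each `s`, the probability that some average
deviates at some time `s' ≥ s`; the exponential supermartingale of a Bernoulli sequence does this at
no cost (`IsBernoulliSeq.measure_exists_le_sum_le`).

At time `n`, all confidence intervals contain the true throughputs except on an event of probability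
`O (1 / (n log n))` (`IsBernoulliSeq.measure_exists_lt_mul_kl_le`, a peeling argument), and these
probabilities sum to `O (log log T)`. Outside this event a channel passing its test has the right
leader, by unimodality. So (`selection_cases`) a selection of `(c, k)` is of one of four kinds.
* A rate of channel `c` which was selected at least as often as `k` deviates by at least a multiple
  of `Δ`: either the leader is wrong, or the test fails although the three rates near the best one
  were often selected. Summed over `s`, the probabilities are `O (Δ⁻²)`.
* `k` is near the best rate and was selected at most `(1 + ε) (log T + 3 log log T) / τ_c` times.
  These selections give the leading term.
* `k` is the best rate of a suboptimal channel, and its average has moved a fixed fraction of the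
  way to the best throughput.
* `(c, k)` is the best pair.

Two uniformities in `θ` make the constants independent of it. A fixed fraction `l`, depending only
on `ε`, is such that an average which moves by less than `l (q - p)` from its mean `p` towards `q`
keeps a divergence to `q` of at least `kl p q / (1 + ε)` (`exists_isKLFraction`). And the third kind
of selections, whose number is not bounded in terms of `Δ` as the gap to the best channel may be
arbitrarily small, costs at most a constant plus a multiple of `c^{CRS-T}(θ)`, by Bernstein's
inequality (`div_bernstein_exponent_le`); that multiple is absorbed by `ε c^{CRS-T}(θ) log T` once
`T` is large in terms of `ε`, `C`, `K` and the rates.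
-/

open MeasureTheory ProbabilityTheory
open scoped ENNReal

/-! ### Maximal inequalities for Bernoulli sequences -/

theorem martingale_prod_of_iIndepFun {Ω : Type*} [MeasurableSpace Ω] {P : Measure Ω}
    [IsProbabilityMeasure P] {Z : ℕ → Ω → ℝ} (hm : ∀ i, Measurable (Z i))
    {B : ℝ} (hB : ∀ i ω, |Z i ω| ≤ B) (hmean : ∀ i, ∫ ω, Z i ω ∂P = 1)
    (hind : iIndepFun Z P) :
    Martingale (fun n ω => ∏ i ∈ Finset.range (n + 1), Z i ω)
      (Filtration.natural Z fun i => (hm i).stronglyMeasurable) P := by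
  have hmp : ∀ n, Measurable (fun ω => ∏ i ∈ Finset.range (n + 1), Z i ω) := fun n =>
    Finset.measurable_prod _ fun i _ => hm i
  have hint : ∀ n, Integrable (fun ω => ∏ i ∈ Finset.range (n + 1), Z i ω) P := fun n => by
    refine Integrable.of_bound (hmp n).aestronglyMeasurable (B ^ (n + 1)) (ae_of_all _ fun ω => ?_)
    rw [Real.norm_eq_abs, Finset.abs_prod]
    calc _ ≤ ∏ _i ∈ Finset.range (n + 1), B :=
          Finset.prod_le_prod (fun _ _ => abs_nonneg _) fun i _ => hB i ω
      _ = _ := by simp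
  have hadp : ∀ n, StronglyMeasurable[Filtration.natural Z (fun i => (hm i).stronglyMeasurable) n]
      (fun ω => ∏ i ∈ Finset.range (n + 1), Z i ω) := fun n => by
    refine Measurable.stronglyMeasurable ?_
    refine Finset.measurable_prod _ fun i hi => ?_
    exact ((Filtration.stronglyAdapted_natural fun i => (hm i).stronglyMeasurable) i).measurable.mono
      ((Filtration.natural Z _).mono (Nat.lt_succ_iff.1 (Finset.mem_range.1 hi))) le_rfl
  refine martingale_nat hadp hint fun n => ?_
  have h1 : P[Z (n + 1) | Filtration.natural Z (fun i => (hm i).stronglyMeasurable) n] =ᵐ[P]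
      fun _ => 1 := by
    have := condExp_indep_eq (m₁ := MeasurableSpace.comap (Z (n + 1)) inferInstance)
      (μ := P) (f := Z (n + 1)) (hm (n + 1)).comap_le
      ((Filtration.natural Z fun i => (hm i).stronglyMeasurable).le n)
      (comap_measurable (Z (n + 1))).stronglyMeasurable
      (hind.indep_comap_natural_of_lt (fun i => (hm i).stronglyMeasurable) (Nat.lt_succ_self n))
    simpa [hmean] using this
  have hZint : Integrable (Z (n + 1)) P :=
    Integrable.of_bound (hm _).aestronglyMeasurable B (ae_of_all _ fun ω => hB _ ω)
  have h2 := condExp_mul_of_stronglyMeasurable_left (μ := P) (hadp n)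
    (g := Z (n + 1)) (by
      refine (hint (n + 1)).congr (ae_of_all _ fun ω => ?_)
      simp [Finset.prod_range_succ _ (n + 1)]) hZint
  have h3 : (fun ω => ∏ i ∈ Finset.range (n + 1 + 1), Z i ω) =
      (fun ω => ∏ i ∈ Finset.range (n + 1), Z i ω) * Z (n + 1) := by
    ext ω; simp [Finset.prod_range_succ _ (n + 1)]
  rw [h3]
  filter_upwards [h1, h2] with ω hω1 hω2
  rw [hω2, Pi.mul_apply, hω1, mul_one]

/-- Ville's inequality for products of independent nonnegative variables of mean `1`. -/
theorem measure_exists_prod_ge_le {Ω : Type*} [MeasurableSpace Ω] {P : Measure Ω}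
    [IsProbabilityMeasure P] {Z : ℕ → Ω → ℝ} (hm : ∀ i, Measurable (Z i)) (h0 : ∀ i ω, 0 ≤ Z i ω)
    {B : ℝ} (hB : ∀ i ω, |Z i ω| ≤ B) (hmean : ∀ i, ∫ ω, Z i ω ∂P = 1)
    (hind : iIndepFun Z P) {a : ℝ} (ha : 0 < a) (N : ℕ) :
    P {ω | ∃ s, 1 ≤ s ∧ s ≤ N ∧ a ≤ ∏ i ∈ Finset.range s, Z i ω} ≤ ENNReal.ofReal a⁻¹ := by
  have hmart := martingale_prod_of_iIndepFun hm hB hmean hind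
  have hmax := maximal_ineq hmart.submartingale
    (fun n ω => Finset.prod_nonneg fun i _ => h0 i ω) (ε := a.toNNReal) N
  set S := {ω | (a.toNNReal : ℝ) ≤ (Finset.range (N + 1)).sup' Finset.nonempty_range_add_one
    fun k => ∏ i ∈ Finset.range (k + 1), Z i ω} with hS
  have hsub : {ω | ∃ s, 1 ≤ s ∧ s ≤ N ∧ a ≤ ∏ i ∈ Finset.range s, Z i ω} ⊆ S := by
    rintro ω ⟨s, h1, h2, h3⟩
    rw [hS, Set.mem_ofPred_eq, Real.coe_toNNReal _ ha.le, Finset.le_sup'_iff]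
    exact ⟨s - 1, Finset.mem_range.2 (by omega), by rwa [Nat.sub_add_cancel h1]⟩
  have hle : ∫ ω in S, ∏ i ∈ Finset.range (N + 1), Z i ω ∂P ≤ 1 := by
    refine (setIntegral_le_integral (hmart.integrable N)
      (ae_of_all _ fun ω => Finset.prod_nonneg fun i _ => h0 i ω)).trans (le_of_eq ?_)
    have h4 := hmart.setIntegral_eq (Nat.zero_le N) (s := Set.univ) MeasurableSet.univ
    simp only [Measure.restrict_univ] at h4
    rw [← h4]
    simpa using hmean 0
  refine (measure_mono hsub).trans ?_
  rw [ENNReal.ofReal_inv_of_pos ha, ← one_div,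
    ENNReal.le_div_iff_mul_le (Or.inl (by simpa using ha)) (Or.inl ENNReal.ofReal_ne_top), mul_comm]
  refine le_trans hmax ?_
  exact (ENNReal.ofReal_le_ofReal hle).trans (by simp)

/-- `Y` is a sequence of independent Bernoulli variables of mean `p`. -/
structure IsBernoulliSeq {Ω : Type*} [MeasurableSpace Ω] (P : Measure Ω) (p : ℝ)
    (Y : ℕ → Ω → ℝ) : Prop where
  measurable : ∀ i, Measurable (Y i)
  binary : ∀ i ω, Y i ω = 0 ∨ Y i ω = 1
  mean : ∀ i, ∫ ω, Y i ω ∂P = p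
  indep : iIndepFun Y P

/-- The average of the first `s` terms of `y`; it is `0` for `s = 0`. -/
noncomputable def avg (y : ℕ → ℝ) (s : ℕ) : ℝ := (∑ i ∈ Finset.range s, y i) / s

theorem avg_mem_Icc {y : ℕ → ℝ} (hy : ∀ i, y i = 0 ∨ y i = 1) (s : ℕ) :
    avg y s ∈ Set.Icc (0 : ℝ) 1 := by
  have h0 : ∀ i, 0 ≤ y i := fun i => by rcases hy i with h | h <;> simp [h]
  have h1 : ∀ i, y i ≤ 1 := fun i => by rcases hy i with h | h <;> simp [h]
  refine ⟨div_nonneg (Finset.sum_nonneg fun i _ => h0 i) (Nat.cast_nonneg _),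
    div_le_one_of_le₀ ?_ (Nat.cast_nonneg _)⟩
  calc _ ≤ ∑ _i ∈ Finset.range s, (1 : ℝ) := Finset.sum_le_sum fun i _ => h1 i
    _ = s := by simp

theorem avg_one_sub (y : ℕ → ℝ) {s : ℕ} (hs : 1 ≤ s) :
    avg (fun i => 1 - y i) s = 1 - avg y s := by
  have : (s : ℝ) ≠ 0 := by positivity
  simp [avg, Finset.sum_sub_distrib, sub_div, this]

theorem sum_eq_mul_avg (y : ℕ → ℝ) {s : ℕ} (hs : 1 ≤ s) :
    ∑ i ∈ Finset.range s, y i = s * avg y s := by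
  have : (s : ℝ) ≠ 0 := by positivity
  rw [avg]; field_simp

namespace IsBernoulliSeq

variable {Ω : Type*} [MeasurableSpace Ω] {P : Measure Ω} [IsProbabilityMeasure P] {p : ℝ}
  {Y : ℕ → Ω → ℝ}

theorem one_sub (h : IsBernoulliSeq P p Y) : IsBernoulliSeq P (1 - p) (fun i ω => 1 - Y i ω) where
  measurable i := measurable_const.sub (h.measurable i)
  binary i ω := by rcases h.binary i ω with h | h <;> simp [h]
  mean i := by
    have hint : Integrable (Y i) P := Integrable.of_bound (h.measurable i).aestronglyMeasurable 1
      (ae_of_all _ fun ω => by rcases h.binary i ω with h | h <;> simp [h])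
    rw [integral_sub (integrable_const _) hint, h.mean]; simp
  indep := h.indep.comp (fun _ x => 1 - x) fun _ => measurable_const.sub measurable_id

theorem integrable (h : IsBernoulliSeq P p Y) (i : ℕ) : Integrable (Y i) P :=
  Integrable.of_bound (h.measurable i).aestronglyMeasurable 1
    (ae_of_all _ fun ω => by rcases h.binary i ω with h | h <;> simp [h])

theorem mean_mem_Icc (h : IsBernoulliSeq P p Y) : p ∈ Set.Icc (0 : ℝ) 1 := by
  rw [← h.mean 0]
  refine ⟨integral_nonneg fun ω => by rcases h.binary 0 ω with h | h <;> simp [h], ?_⟩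
  calc _ ≤ ∫ _ω, (1 : ℝ) ∂P := integral_mono (h.integrable 0) (integrable_const _)
        fun ω => by rcases h.binary 0 ω with h | h <;> simp [h]
    _ = 1 := by simp

theorem mgf (h : IsBernoulliSeq P p Y) (t : ℝ) (i : ℕ) :
    ∫ ω, Real.exp (t * Y i ω) ∂P = 1 - p + p * Real.exp t := by
  have : ∀ ω, Real.exp (t * Y i ω) = 1 + Y i ω * (Real.exp t - 1) := fun ω => by
    rcases h.binary i ω with h | h <;> simp [h]
  simp_rw [this]
  rw [integral_add (integrable_const _) ((h.integrable i).mul_const _), integral_mul_const, h.mean]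
  simp; ring

/-- Chernoff bound, uniform over all times `s ≥ m`: the exponential supermartingale
`exp (t S_s - s ψ)` rarely exceeds `exp (m (t x - ψ))`. The condition on `S_s` is multiplied by `t`,
so that both signs of `t`, that is both tails, are covered. -/
theorem measure_exists_le_sum_le (h : IsBernoulliSeq P p Y) {t ψ x m : ℝ}
    (hψ : 1 - p + p * Real.exp t ≤ Real.exp ψ) (hx : 0 ≤ t * x - ψ) (N : ℕ) :
    P {ω | ∃ s : ℕ, 1 ≤ s ∧ s ≤ N ∧ m ≤ s ∧ s * (t * x) ≤ t * ∑ i ∈ Finset.range s, Y i ω} ≤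
      ENNReal.ofReal (Real.exp (-(m * (t * x - ψ)))) := by
  have hp := h.mean_mem_Icc
  have hpos : 0 < 1 - p + p * Real.exp t := by
    have h1 := Real.exp_pos t
    rcases hp.1.eq_or_lt with h0 | h0
    · rw [← h0]; norm_num
    · have := hp.2; nlinarith [mul_pos h0 h1]
  set ψ₀ := Real.log (1 - p + p * Real.exp t) with hψ₀
  have hψ₀' : ψ₀ ≤ ψ := (Real.log_le_iff_le_exp hpos).2 hψ
  have hZ := measure_exists_prod_ge_le (P := P) (Z := fun i ω => Real.exp (t * Y i ω - ψ₀))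
    (fun i => (((h.measurable i).const_mul t).sub_const _).exp) (fun i ω => (Real.exp_pos _).le)
    (B := Real.exp (|t| - ψ₀)) (fun i ω => by
      rw [Real.abs_exp, Real.exp_le_exp]
      rcases h.binary i ω with h | h <;> simp [h, le_abs_self])
    (fun i => by
      simp_rw [Real.exp_sub]
      rw [integral_div, h.mgf, hψ₀, Real.exp_log hpos, div_self hpos.ne'])
    (h.indep.comp (fun _ x => Real.exp (t * x - ψ₀)) fun _ => by fun_prop)
    (Real.exp_pos (m * (t * x - ψ))) N
  rw [← Real.exp_neg] at hZ
  refine (measure_mono ?_).trans hZ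
  rintro ω ⟨s, h1, h2, h3, h4⟩
  refine ⟨s, h1, h2, ?_⟩
  rw [← Real.exp_sum, Real.exp_le_exp, Finset.sum_sub_distrib, ← Finset.mul_sum]
  simp only [Finset.sum_const, Finset.card_range, nsmul_eq_mul]
  have h5 : (m : ℝ) * (t * x - ψ) ≤ s * (t * x - ψ) := mul_le_mul_of_nonneg_right h3 hx
  have h6 : (s : ℝ) * ψ₀ ≤ s * ψ := mul_le_mul_of_nonneg_left hψ₀' (Nat.cast_nonneg _)
  linarith

/-- The moment generating function of a centred Bernoulli variable is controlled by its variance,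
through `exp u ≤ 1 + u + u ^ 2` for `|u| ≤ 1`. -/
theorem mgf_le (hp : p ∈ Set.Icc (0 : ℝ) 1) {t : ℝ} (ht0 : 0 ≤ t) (ht1 : t ≤ 1) :
    1 - p + p * Real.exp t ≤ Real.exp (t * p + p * (1 - p) * t ^ 2) := by
  have key : ∀ u : ℝ, |u| ≤ 1 → Real.exp u ≤ 1 + u + u ^ 2 := fun u hu => by
    have := (abs_le.1 (Real.abs_exp_sub_one_sub_id_le hu)).2
    linarith
  have hp0 := hp.1
  have hp1 := hp.2
  have h1 := key (t * (1 - p)) (abs_le.2 ⟨by nlinarith, by nlinarith⟩)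
  have h2 := key (-(t * p)) (abs_le.2 ⟨by nlinarith, by nlinarith⟩)
  have h3 : 1 - p + p * Real.exp t =
      Real.exp (t * p) * ((1 - p) * Real.exp (-(t * p)) + p * Real.exp (t * (1 - p))) := by
    rw [mul_add, mul_left_comm, ← Real.exp_add, mul_left_comm _ p, ← Real.exp_add]
    ring_nf; simp; ring
  have h4 := Real.add_one_le_exp (p * (1 - p) * t ^ 2)
  rw [h3, Real.exp_add]
  refine mul_le_mul_of_nonneg_left (le_trans ?_ h4) (Real.exp_pos _).le
  calc (1 - p) * Real.exp (-(t * p)) + p * Real.exp (t * (1 - p))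
      ≤ (1 - p) * (1 + (-(t * p)) + (-(t * p)) ^ 2) +
          p * (1 + t * (1 - p) + (t * (1 - p)) ^ 2) :=
        add_le_add (mul_le_mul_of_nonneg_left h2 (by linarith)) (mul_le_mul_of_nonneg_left h1 hp0)
    _ = _ := by ring

/-- Bernstein's inequality, uniform over all times `s ≥ m`. The variance in the exponent matters
for a best throughput close to that of a suboptimal channel, see `div_bernstein_exponent_le`. -/
theorem bernstein (h : IsBernoulliSeq P p Y) {z : ℝ} (hz : 0 < z) (m N : ℕ) :
    P {ω | ∃ s : ℕ, 1 ≤ s ∧ m ≤ s ∧ s ≤ N ∧ p + z ≤ avg (fun i => Y i ω) s} ≤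
      ENNReal.ofReal (Real.exp (-(m * (z ^ 2 / (4 * (p * (1 - p) + z)))))) := by
  have hp := h.mean_mem_Icc
  have hv : 0 ≤ p * (1 - p) := mul_nonneg hp.1 (by linarith [hp.2])
  set v := p * (1 - p) with hvdef
  -- the optimal `t` would be `z / (2 v)`; the extra `z` keeps it below `1`
  set t := z / (2 * (v + z)) with ht
  have hvz : 0 < v + z := by linarith
  have ht0 : 0 < t := by positivity
  have ht1 : t ≤ 1 := by rw [ht, div_le_one (by positivity)]; linarith
  have hexp : z ^ 2 / (4 * (v + z)) ≤ t * (p + z) - (t * p + v * t ^ 2) := by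
    have : t * (p + z) - (t * p + v * t ^ 2) - z ^ 2 / (4 * (v + z)) =
        z ^ 3 / (4 * (v + z) ^ 2) := by
      rw [ht]; field_simp; ring
    have h2 : 0 ≤ z ^ 3 / (4 * (v + z) ^ 2) := by positivity
    linarith
  have hpos : 0 ≤ z ^ 2 / (4 * (v + z)) := by positivity
  have hmain := h.measure_exists_le_sum_le (m := m) (x := p + z)
    (mgf_le hp ht0.le ht1) (hpos.trans hexp) N
  refine (measure_mono ?_).trans (hmain.trans (ENNReal.ofReal_le_ofReal (Real.exp_le_exp.2
    (neg_le_neg (mul_le_mul_of_nonneg_left hexp (Nat.cast_nonneg _))))))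
  rintro ω ⟨s, h1, h2, h3, h4⟩
  refine ⟨s, h1, h3, by exact_mod_cast h2, ?_⟩
  rw [sum_eq_mul_avg _ h1]
  calc (s : ℝ) * (t * (p + z)) ≤ s * (t * avg (fun i => Y i ω) s) := by gcongr
    _ = _ := by ring

theorem measure_abs_avg_sub_ge_le (h : IsBernoulliSeq P p Y) {z : ℝ} (hz : 0 < z) (m N : ℕ) :
    P {ω | ∃ s : ℕ, 1 ≤ s ∧ m ≤ s ∧ s ≤ N ∧ z ≤ |avg (fun i => Y i ω) s - p|} ≤
      ENNReal.ofReal (2 * Real.exp (-(m * (z ^ 2 / 5)))) := by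
  have hp := h.mean_mem_Icc
  rcases lt_or_ge 1 z with hz1 | hz1
  · have : {ω | ∃ s : ℕ, 1 ≤ s ∧ m ≤ s ∧ s ≤ N ∧ z ≤ |avg (fun i => Y i ω) s - p|} = ∅ := by
      ext ω
      simp only [Set.mem_ofPred_eq, Set.mem_empty_iff_false, iff_false, not_exists, not_and, not_le]
      intro s _ _ _
      have h1 := avg_mem_Icc (y := fun i => Y i ω) (fun i => h.binary i ω) s
      refine lt_of_le_of_lt (abs_le.2 ⟨?_, ?_⟩) hz1 <;> linarith [h1.1, h1.2, hp.1, hp.2]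
    rw [this]; simp
  have hle : ∀ v : ℝ, v = p * (1 - p) →
      Real.exp (-(m * (z ^ 2 / (4 * (v + z))))) ≤ Real.exp (-(m * (z ^ 2 / 5))) := by
    intro v hv
    have hv4 : v ≤ 1 / 4 := by rw [hv]; nlinarith [sq_nonneg (p - 1 / 2)]
    have hv0 : 0 ≤ v := by rw [hv]; exact mul_nonneg hp.1 (by linarith [hp.2])
    rw [Real.exp_le_exp]
    refine neg_le_neg (mul_le_mul_of_nonneg_left ?_ (Nat.cast_nonneg _))
    exact div_le_div_of_nonneg_left (by positivity) (by linarith) (by linarith)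
  rw [two_mul, ENNReal.ofReal_add (Real.exp_pos _).le (Real.exp_pos _).le]
  refine (measure_mono (t := {ω | ∃ s : ℕ, 1 ≤ s ∧ m ≤ s ∧ s ≤ N ∧
      p + z ≤ avg (fun i => Y i ω) s} ∪ {ω | ∃ s : ℕ, 1 ≤ s ∧ m ≤ s ∧ s ≤ N ∧
      1 - p + z ≤ avg (fun i => 1 - Y i ω) s}) ?_).trans ((measure_union_le _ _).trans
      (add_le_add ((h.bernstein hz m N).trans (ENNReal.ofReal_le_ofReal (hle _ rfl)))
        ((h.one_sub.bernstein hz m N).trans (ENNReal.ofReal_le_ofReal (hle _ (by ring))))))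
  rintro ω ⟨s, h1, h2, h3, h4⟩
  rcases le_abs.1 h4 with h5 | h5
  · exact Or.inl ⟨s, h1, h2, h3, by linarith⟩
  · exact Or.inr ⟨s, h1, h2, h3, by rw [avg_one_sub _ h1]; linarith⟩

end IsBernoulliSeq

/-! ### The Bernoulli divergence -/

/-- The real-valued formula for the Bernoulli divergence, meaningful for `0 < q < 1`. -/
noncomputable def bernDiv (p q : ℝ) : ℝ :=
  p * Real.log (p / q) + (1 - p) * Real.log ((1 - p) / (1 - q))

theorem kl_eq_ofReal_bernDiv {p q : ℝ} (hq0 : 0 < q) (hq1 : q < 1) :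
    CRS.kl p q = ENNReal.ofReal (bernDiv p q) := by
  rw [CRS.kl, if_pos ⟨hq0.le, hq1.le, fun h => absurd h hq0.ne', fun h => absurd h hq1.ne⟩]; rfl

theorem kl_one_right {p : ℝ} (hp : p ≠ 1) : CRS.kl p 1 = ⊤ := by
  rw [CRS.kl, if_neg]; rintro ⟨_, _, _, h⟩; exact hp (h rfl)

theorem kl_one_sub (p q : ℝ) : CRS.kl (1 - p) (1 - q) = CRS.kl p q := by
  unfold CRS.kl
  have : (0 ≤ 1 - q ∧ 1 - q ≤ 1 ∧ (1 - q = 0 → 1 - p = 0) ∧ (1 - q = 1 → 1 - p = 1)) ↔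
      (0 ≤ q ∧ q ≤ 1 ∧ (q = 0 → p = 0) ∧ (q = 1 → p = 1)) := by
    constructor
    · rintro ⟨h1, h2, h3, h4⟩
      refine ⟨by linarith, by linarith, fun h => ?_, fun h => ?_⟩
      · have := h4 (by linarith); linarith
      · have := h3 (by linarith); linarith
    · rintro ⟨h1, h2, h3, h4⟩
      refine ⟨by linarith, by linarith, fun h => ?_, fun h => ?_⟩
      · have := h4 (by linarith); linarith
      · have := h3 (by linarith); linarith
  simp only [this, sub_sub_cancel]
  congr 2
  ring

theorem mul_log_div_eq {p q : ℝ} (hq : q ≠ 0) :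
    p * Real.log (p / q) = p * Real.log p - p * Real.log q := by
  rcases eq_or_ne p 0 with rfl | hp
  · simp
  · rw [Real.log_div hp hq]; ring

theorem bernDiv_eq {p q : ℝ} (hq0 : 0 < q) (hq1 : q < 1) : bernDiv p q =
    p * Real.log p + (1 - p) * Real.log (1 - p) - p * Real.log q - (1 - p) * Real.log (1 - q) := by
  rw [bernDiv, mul_log_div_eq hq0.ne', mul_log_div_eq (by linarith)]; ring

theorem bernDiv_self (p : ℝ) : bernDiv p p = 0 := by
  unfold bernDiv
  rcases eq_or_ne p 0 with rfl | hp
  · simp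
  rcases eq_or_ne p 1 with rfl | hp1
  · simp
  rw [div_self hp, div_self (sub_ne_zero.2 hp1.symm)]; simp

theorem sub_le_mul_log_div {p q : ℝ} (hp : 0 ≤ p) (hq : 0 < q) : p - q ≤ p * Real.log (p / q) := by
  rcases hp.eq_or_lt with rfl | hp
  · simp [hq.le]
  have h := Real.one_sub_inv_le_log_of_pos (div_pos hp hq)
  calc p - q = p * (1 - (p / q)⁻¹) := by field_simp
    _ ≤ _ := mul_le_mul_of_nonneg_left h hp.le

theorem sub_lt_mul_log_div {p q : ℝ} (hp : 0 ≤ p) (hq : 0 < q) (hpq : p ≠ q) :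
    p - q < p * Real.log (p / q) := by
  rcases hp.eq_or_lt with rfl | hp
  · simp [hq]
  have h := Real.log_lt_sub_one_of_pos (div_pos hq hp) fun h => hpq ((div_eq_one_iff_eq hp.ne').1 h).symm
  have h2 : Real.log (p / q) = -Real.log (q / p) := by rw [← Real.log_inv, inv_div]
  calc p - q = p * -(q / p - 1) := by field_simp; ring
    _ < _ := by rw [h2]; exact mul_lt_mul_of_pos_left (neg_lt_neg h) hp

theorem bernDiv_nonneg {p q : ℝ} (hp : p ∈ Set.Icc (0 : ℝ) 1) (hq0 : 0 < q) (hq1 : q < 1) :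
    0 ≤ bernDiv p q := by
  have h1 := sub_le_mul_log_div hp.1 hq0
  have h2 := sub_le_mul_log_div (p := 1 - p) (q := 1 - q) (by linarith [hp.2]) (by linarith)
  unfold bernDiv; linarith

theorem bernDiv_pos {p q : ℝ} (hp : p ∈ Set.Icc (0 : ℝ) 1) (hq0 : 0 < q) (hq1 : q < 1)
    (hpq : p ≠ q) : 0 < bernDiv p q := by
  have h1 := sub_lt_mul_log_div hp.1 hq0 hpq
  have h2 := sub_le_mul_log_div (p := 1 - p) (q := 1 - q) (by linarith [hp.2]) (by linarith)
  unfold bernDiv; linarith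

theorem kl_pos {p q : ℝ} (hp : p ∈ Set.Icc (0 : ℝ) 1) (hpq : p ≠ q) : 0 < CRS.kl p q := by
  by_cases hq : 0 < q ∧ q < 1
  · rw [kl_eq_ofReal_bernDiv hq.1 hq.2]
    exact ENNReal.ofReal_pos.2 (bernDiv_pos hp hq.1 hq.2 hpq)
  · rw [CRS.kl, if_neg]
    · exact ENNReal.zero_lt_top
    rintro ⟨h1, h2, h3, h4⟩
    rcases h1.eq_or_lt with h | h
    · exact hpq (by rw [h3 h.symm, h])
    · rcases h2.eq_or_lt with h' | h'
      · exact hpq (by rw [h4 h', h'])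
      · exact hq ⟨h, h'⟩

theorem mul_log_div_le {p q : ℝ} (hp : 0 ≤ p) (hq : 0 < q) :
    p * Real.log (p / q) ≤ p * (p / q - 1) := by
  rcases hp.eq_or_lt with rfl | hp
  · simp
  exact mul_le_mul_of_nonneg_left (Real.log_le_sub_one_of_pos (div_pos hp hq)) hp.le

/-- The divergence is at most the chi-square distance. -/
theorem bernDiv_le_sq_div {p q : ℝ} (hp : p ∈ Set.Icc (0 : ℝ) 1) (hq0 : 0 < q) (hq1 : q < 1) :
    bernDiv p q ≤ (q - p) ^ 2 / (q * (1 - q)) := by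
  have h1 := mul_log_div_le hp.1 hq0
  have h2 := mul_log_div_le (p := 1 - p) (q := 1 - q) (by linarith [hp.2]) (by linarith)
  have h3 : (1 - q) ≠ 0 := by linarith
  calc bernDiv p q ≤ p * (p / q - 1) + (1 - p) * ((1 - p) / (1 - q) - 1) := add_le_add h1 h2
    _ = _ := by field_simp; ring

/-- The divergence from `p` is convex in its second argument and vanishes at `p`. -/
theorem bernDiv_segment_le {p q κ : ℝ} (hp0 : 0 ≤ p) (hpq : p < q) (hq : q < 1) (hκ0 : 0 < κ)
    (hκ1 : κ ≤ 1) : bernDiv p (p + κ * (q - p)) ≤ κ * bernDiv p q := by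
  have hz0 : 0 < p + κ * (q - p) := by have := mul_pos hκ0 (sub_pos.2 hpq); linarith
  have hz1 : p + κ * (q - p) < 1 := by nlinarith
  have hconc := strictConcaveOn_log_Ioi.concaveOn.2
  have h1 : p * ((1 - κ) * Real.log p + κ * Real.log q) ≤ p * Real.log (p + κ * (q - p)) := by
    rcases hp0.eq_or_lt with rfl | hp0
    · simp
    refine mul_le_mul_of_nonneg_left ?_ hp0.le
    have := hconc (Set.mem_Ioi.2 hp0) (Set.mem_Ioi.2 (hp0.trans hpq)) (sub_nonneg.2 hκ1) hκ0.le
      (by ring)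
    simp only [smul_eq_mul] at this
    rwa [show (1 - κ) * p + κ * q = p + κ * (q - p) by ring] at this
  have h2 : (1 - κ) * Real.log (1 - p) + κ * Real.log (1 - q) ≤
      Real.log (1 - (p + κ * (q - p))) := by
    have := hconc (Set.mem_Ioi.2 (by linarith : 0 < 1 - p)) (Set.mem_Ioi.2 (by linarith : 0 < 1 - q))
      (sub_nonneg.2 hκ1) hκ0.le (by ring)
    simp only [smul_eq_mul] at this
    rwa [show (1 - κ) * (1 - p) + κ * (1 - q) = 1 - (p + κ * (q - p)) by ring] at this
  have h3 := mul_le_mul_of_nonneg_left h2 (by linarith : 0 ≤ 1 - p)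
  rw [bernDiv_eq hz0 hz1, bernDiv_eq (hp0.trans_lt hpq) hq]
  nlinarith

theorem hasDerivAt_bernDiv {y q : ℝ} (hq0 : 0 < q) (hq1 : q < 1) :
    HasDerivAt (bernDiv y) ((q - y) / (q * (1 - q))) q := by
  have h1 : HasDerivAt (fun q => y * Real.log y + (1 - y) * Real.log (1 - y) - y * Real.log q
      - (1 - y) * Real.log (1 - q)) ((q - y) / (q * (1 - q))) q := by
    have h3 : (1 - q) ≠ 0 := by linarith
    have h4 := (((hasDerivAt_id q).const_sub 1).log h3).const_mul (1 - y)
    have h5 := ((Real.hasDerivAt_log hq0.ne').const_mul y).const_sub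
      (y * Real.log y + (1 - y) * Real.log (1 - y))
    exact (h5.sub h4).congr_deriv (by simp only [id]; field_simp; ring)
  refine h1.congr_of_eventuallyEq ?_
  filter_upwards [Ioo_mem_nhds hq0 hq1] with u hu
  exact bernDiv_eq hu.1 hu.2

/-- Moving the first argument of the divergence from `p` towards `q` by at most a small fraction
`l` of the distance decreases the divergence by at most a factor `c (1 - l / (1 - c))`, uniformly
in `p` and `q`. The derivative of `u ↦ bernDiv y u - c * bernDiv p u` is nonnegative on `[z, q]` for
`z = p + l / (1 - c) * (q - p)`, and `bernDiv p z` is small by convexity. -/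
theorem mul_bernDiv_le_of_le {p q y c l : ℝ} (hp0 : 0 ≤ p) (hpq : p < q) (hq : q < 1)
    (hy0 : 0 ≤ y) (hc0 : 0 ≤ c) (hl : 0 < l) (hlc : l < 1 - c) (hy : y ≤ p + l * (q - p)) :
    c * (1 - l / (1 - c)) * bernDiv p q ≤ bernDiv y q := by
  have hc1 : 0 < 1 - c := by linarith
  set κ := l / (1 - c) with hκ
  have hκ0 : 0 < κ := by positivity
  have hκ1 : κ < 1 := by rw [hκ, div_lt_one hc1]; exact hlc
  have hκl : κ * (1 - c) = l := by rw [hκ]; field_simp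
  set z := p + κ * (q - p) with hz
  have hd : 0 < q - p := by linarith
  have hz0 : 0 < z := by have := mul_pos hκ0 hd; linarith
  have hzq : z < q := by nlinarith
  have hmono : MonotoneOn (fun u => bernDiv y u - c * bernDiv p u) (Set.Icc z q) := by
    have hder : ∀ u ∈ Set.Icc z q, HasDerivAt (fun u => bernDiv y u - c * bernDiv p u)
        ((u - y) / (u * (1 - u)) - c * ((u - p) / (u * (1 - u)))) u := fun u hu =>
      (hasDerivAt_bernDiv (by linarith [hu.1]) (by linarith [hu.2])).sub
        ((hasDerivAt_bernDiv (by linarith [hu.1]) (by linarith [hu.2])).const_mul c)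
    refine monotoneOn_of_deriv_nonneg (convex_Icc _ _)
      (fun u hu => (hder u hu).continuousAt.continuousWithinAt)
      (fun u hu => (hder u (interior_subset hu)).differentiableAt.differentiableWithinAt)
      fun u hu => ?_
    have hu := interior_subset hu
    rw [(hder u hu).deriv]
    have h1 : (u - y) / (u * (1 - u)) - c * ((u - p) / (u * (1 - u))) =
        ((u - y) - c * (u - p)) / (u * (1 - u)) := by ring
    rw [h1]
    refine div_nonneg ?_ (mul_nonneg (by linarith [hu.1]) (by linarith [hu.2]))
    have h2 : (1 - c) * z ≤ (1 - c) * u := mul_le_mul_of_nonneg_left hu.1 hc1.le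
    have h3 : (1 - c) * z = (1 - c) * p + l * (q - p) := by rw [hz, ← hκl]; ring
    linarith
  have h4 := hmono (Set.left_mem_Icc.2 hzq.le) (Set.right_mem_Icc.2 hzq.le) hzq.le
  have hy1 : y ≤ 1 := by nlinarith
  have h5 := bernDiv_nonneg ⟨hy0, hy1⟩ hz0 (hzq.trans hq)
  have h6 := mul_le_mul_of_nonneg_left (bernDiv_segment_le hp0 hpq hq hκ0 hκ1.le) hc0
  simp only at h4
  linarith

/-- `l` is a fraction such that moving the first argument of the divergence `kl p q` from `p`
towards `q > p` by at most `l * (q - p)` decreases the divergence by at most a factor `1 + ε`. The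
moved argument `y` may also lie below `p`. -/
def IsKLFraction (ε l : ℝ) : Prop :=
  ∀ p q y : ℝ, 0 ≤ p → p < q → q ≤ 1 → 0 ≤ y → y ≤ p + l * (q - p) →
    CRS.kl p q ≤ ENNReal.ofReal (1 + ε) * CRS.kl y q

theorem exists_isKLFraction {ε : ℝ} (hε : 0 < ε) :
    ∃ l : ℝ, 0 < l ∧ l < 1 ∧ IsKLFraction ε l := by
  -- `c` and `l` are chosen so that `c (1 - l / (1 - c)) = (1 - e / 2) ^ 2 ≥ 1 / (1 + ε)`
  set e := ε / (2 + ε) with he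
  have he0 : 0 < e := by positivity
  have he1 : e < 1 := by rw [he, div_lt_one (by positivity)]; linarith
  set c := 1 - e / 2 with hc
  refine ⟨e ^ 2 / 4, by positivity, by nlinarith, fun p q y hp hpq hq hy hyl => ?_⟩
  have hp1 : p ∈ Set.Icc (0 : ℝ) 1 := ⟨hp, by linarith⟩
  have hyq : y < q := by
    have : e ^ 2 / 4 < 1 := by nlinarith
    nlinarith
  rcases hq.eq_or_lt with rfl | hq
  · rw [kl_one_right hyq.ne, ENNReal.mul_top (by simpa using by linarith)]; exact le_top
  have hq0 : 0 < q := by linarith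
  rw [kl_eq_ofReal_bernDiv hq0 hq, kl_eq_ofReal_bernDiv hq0 hq, ← ENNReal.ofReal_mul (by linarith)]
  refine ENNReal.ofReal_le_ofReal ?_
  have h := mul_bernDiv_le_of_le (c := c) (l := e ^ 2 / 4) hp hpq hq hy (by linarith)
    (by positivity) (by nlinarith) hyl
  have h1 : 1 - e ^ 2 / 4 / (1 - c) = 1 - e / 2 := by
    rw [hc, sub_sub_cancel]; field_simp; ring
  rw [h1, hc] at h
  have h2 : 1 ≤ (1 + ε) * ((1 - e / 2) * (1 - e / 2)) := by
    have : (1 + ε) * (1 - e) = 1 + ε * (1 - e) - e := by ring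
    have h3 : e * (2 + ε) = ε := by rw [he]; field_simp
    nlinarith [sq_nonneg e]
  have h4 := bernDiv_nonneg hp1 hq0 hq
  calc bernDiv p q = 1 * bernDiv p q := by ring
    _ ≤ (1 + ε) * ((1 - e / 2) * (1 - e / 2)) * bernDiv p q := mul_le_mul_of_nonneg_right h2 h4
    _ = (1 + ε) * ((1 - e / 2) * (1 - e / 2) * bernDiv p q) := by ring
    _ ≤ _ := mul_le_mul_of_nonneg_left h (by linarith)

theorem kl_self {p : ℝ} (hp : p ∈ Set.Icc (0 : ℝ) 1) : CRS.kl p p = 0 := by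
  rw [CRS.kl, if_pos ⟨hp.1, hp.2, id, id⟩]
  have := bernDiv_self p
  rw [bernDiv] at this
  rw [this, ENNReal.ofReal_zero]

theorem kl_mono_right {y q q' : ℝ} (hy : 0 ≤ y) (hyq : y ≤ q) (hqq' : q ≤ q') :
    CRS.kl y q ≤ CRS.kl y q' := by
  rcases hqq'.eq_or_lt with rfl | hqq'
  · exact le_rfl
  by_cases hq' : q' < 1
  · rcases hyq.eq_or_lt with rfl | hyq
    · rw [kl_self ⟨hy, by linarith⟩]; exact zero_le
    have hq0 : 0 < q := by linarith
    rw [kl_eq_ofReal_bernDiv hq0 (by linarith), kl_eq_ofReal_bernDiv (by linarith) hq']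
    refine ENNReal.ofReal_le_ofReal ?_
    have hd : 0 < q' - y := by linarith
    have h := bernDiv_segment_le (κ := (q - y) / (q' - y)) hy (hyq.trans hqq') hq'
      (div_pos (by linarith) hd) ((div_le_one hd).2 (by linarith))
    have h1 : y + (q - y) / (q' - y) * (q' - y) = q := by rw [div_mul_cancel₀ _ hd.ne']; ring
    rw [h1] at h
    refine h.trans (mul_le_of_le_one_left ?_ ((div_le_one hd).2 (by linarith)))
    exact bernDiv_nonneg ⟨hy, by linarith⟩ (by linarith) hq'
  · have : CRS.kl y q' = ⊤ := by
      rw [CRS.kl, if_neg]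
      rintro ⟨_, h2, _, h4⟩
      have := h4 (by linarith)
      linarith
    rw [this]; exact le_top

/-- The sublevel sets of the divergence through powers, which are continuous in `q` up to the
endpoints, where the divergence jumps to `∞`. The convention `0 ^ 0 = 1` is the right one here. -/
theorem kl_le_iff {p q z : ℝ} (hp : p ∈ Set.Icc (0 : ℝ) 1) (hq : q ∈ Set.Icc (0 : ℝ) 1)
    (hz : 0 ≤ z) : CRS.kl p q ≤ ENNReal.ofReal z ↔
      Real.exp (-z) * (p ^ p * (1 - p) ^ (1 - p)) ≤ q ^ p * (1 - q) ^ (1 - p) := by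
  have hpow : ∀ u v : ℝ, 0 ≤ u → 0 < v → v ^ u = Real.exp (u * Real.log v) := fun u v _ hv => by
    rw [Real.rpow_def_of_pos hv, mul_comm]
  have hself : ∀ u : ℝ, 0 ≤ u → u ^ u = Real.exp (u * Real.log u) := fun u hu => by
    rcases hu.eq_or_lt with rfl | hu
    · simp
    · exact hpow u u hu.le hu
  have hp1 : 0 ≤ 1 - p := by linarith [hp.2]
  have hpos : 0 < Real.exp (-z) * (p ^ p * (1 - p) ^ (1 - p)) := by
    rw [hself p hp.1, hself _ hp1]; positivity
  rcases hq.1.eq_or_lt with rfl | hq0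
  · rcases hp.1.eq_or_lt with rfl | hp0
    · rw [kl_self hp]; simp [hz]
    · have : CRS.kl p 0 = ⊤ := by
        rw [CRS.kl, if_neg]; rintro ⟨_, _, h3, _⟩; exact hp0.ne' (h3 rfl)
      rw [this, Real.zero_rpow hp0.ne', zero_mul]
      simp [hpos]
  rcases hq.2.eq_or_lt with rfl | hq1
  · rcases eq_or_ne p 1 with rfl | hp1'
    · rw [kl_self hp]; simp [hz]
    · rw [kl_one_right hp1', sub_self, Real.zero_rpow (sub_ne_zero.2 hp1'.symm), mul_zero]
      simp [hpos]
  · rw [kl_eq_ofReal_bernDiv hq0 hq1, ENNReal.ofReal_le_ofReal_iff hz, bernDiv_eq hq0 hq1,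
      hself p hp.1, hself _ hp1, hpow p q hp.1 hq0, hpow _ (1 - q) hp1 (by linarith),
      ← Real.exp_add, ← Real.exp_add, ← Real.exp_add, Real.exp_le_exp]
    constructor <;> intro h <;> linarith

theorem isClosed_setOf_kl_le {p z : ℝ} (hp : p ∈ Set.Icc (0 : ℝ) 1) (hz : 0 ≤ z) :
    IsClosed {q | q ∈ Set.Icc (0 : ℝ) 1 ∧ CRS.kl p q ≤ ENNReal.ofReal z} := by
  have : {q | q ∈ Set.Icc (0 : ℝ) 1 ∧ CRS.kl p q ≤ ENNReal.ofReal z} = Set.Icc (0 : ℝ) 1 ∩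
      {q | Real.exp (-z) * (p ^ p * (1 - p) ^ (1 - p)) ≤ q ^ p * (1 - q) ^ (1 - p)} := by
    ext q
    exact and_congr_right fun hq => kl_le_iff hp hq hz
  rw [this]
  refine isClosed_Icc.inter (isClosed_le continuous_const ?_)
  exact (Real.continuous_rpow_const hp.1).mul
    ((Real.continuous_rpow_const (by linarith [hp.2])).comp (continuous_const.sub continuous_id))

/-! ### Self-normalized deviations -/

theorem continuous_bernDiv_left {p : ℝ} (hp0 : 0 < p) (hp1 : p < 1) :
    Continuous fun y => bernDiv y p := by
  simp_rw [bernDiv_eq hp0 hp1]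
  have h := Real.continuous_mul_log
  have h2 : Continuous fun y : ℝ => (1 - y) * Real.log (1 - y) :=
    h.comp (continuous_const.sub continuous_id)
  fun_prop

theorem antitoneOn_bernDiv_left {p : ℝ} (hp0 : 0 < p) (hp1 : p < 1) :
    AntitoneOn (fun y => bernDiv y p) (Set.Icc 0 p) := by
  have hder : ∀ y ∈ Set.Ioo 0 p, HasDerivAt (fun y => bernDiv y p)
      (Real.log y - Real.log (1 - y) - Real.log p + Real.log (1 - p)) y := fun y hy => by
    simp_rw [bernDiv_eq hp0 hp1]
    have h1 := Real.hasDerivAt_mul_log hy.1.ne'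
    have h2 : HasDerivAt (fun y : ℝ => (1 - y) * Real.log (1 - y))
        ((Real.log (1 - y) + 1) * (-1)) y :=
      (Real.hasDerivAt_mul_log (by linarith [hy.2] : (1 - y) ≠ 0)).comp y
        ((hasDerivAt_id y).const_sub 1)
    have h3 := (h1.add h2).sub ((hasDerivAt_id y).mul_const (Real.log p))
    have h4 := h3.sub (((hasDerivAt_id y).const_sub 1).mul_const (Real.log (1 - p)))
    exact h4.congr_deriv (by ring)
  refine antitoneOn_of_deriv_nonpos (convex_Icc _ _) (continuous_bernDiv_left hp0 hp1).continuousOn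
    (fun y hy => ?_) fun y hy => ?_
  · rw [interior_Icc] at hy
    exact (hder y hy).differentiableAt.differentiableWithinAt
  · rw [interior_Icc] at hy
    rw [(hder y hy).deriv]
    have h1 := Real.log_le_log hy.1 hy.2.le
    have h2 := Real.log_le_log (by linarith : 0 < 1 - p) (by linarith [hy.2] : 1 - p ≤ 1 - y)
    linarith

namespace IsBernoulliSeq

variable {Ω : Type*} [MeasurableSpace Ω] {P : Measure Ω} [IsProbabilityMeasure P] {p : ℝ}
  {Y : ℕ → Ω → ℝ}

theorem ae_eq_one (h : IsBernoulliSeq P 1 Y) : ∀ᵐ ω ∂P, ∀ i, Y i ω = 1 := by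
  rw [ae_all_iff]
  intro i
  have h1 : ∫ ω, (1 - Y i ω) ∂P = 0 := by
    rw [integral_sub (integrable_const _) (h.integrable i), h.mean]; simp
  have h2 := (integral_eq_zero_iff_of_nonneg (f := fun ω => 1 - Y i ω)
    (fun ω => by rcases h.binary i ω with h | h <;> simp [h])
    ((integrable_const _).sub (h.integrable i))).1 h1
  filter_upwards [h2] with ω hω
  simp only [Pi.zero_apply] at hω
  linarith

/-- Chernoff's bound in divergence form for the lower tail, uniform over all times `s ≥ m`: the
event is that the average falls below the point `x < p` with `kl x p = z`. -/
theorem measure_exists_lt_kl_le (h : IsBernoulliSeq P p Y) {z : ℝ} (hz : 0 ≤ z) (m : ℝ)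
    (N : ℕ) :
    P {ω | ∃ s : ℕ, 1 ≤ s ∧ s ≤ N ∧ m ≤ s ∧ avg (fun i => Y i ω) s < p ∧
      ENNReal.ofReal z < CRS.kl (avg (fun i => Y i ω) s) p} ≤
      ENNReal.ofReal (Real.exp (-(m * z))) := by
  have hp := h.mean_mem_Icc
  rcases hz.eq_or_lt with rfl | hz
  · simpa using prob_le_one
  have havg : ∀ s ω, avg (fun i => Y i ω) s ∈ Set.Icc (0 : ℝ) 1 := fun s ω =>
    avg_mem_Icc (fun i => h.binary i ω) s
  rcases hp.2.eq_or_lt with rfl | hp1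
  · have h0 : P {ω | ¬ ∀ i, Y i ω = 1} = 0 := h.ae_eq_one
    refine (measure_mono ?_).trans (h0.le.trans zero_le)
    rintro ω ⟨s, h1, _, _, h2, _⟩ hω
    rw [avg] at h2
    simp only [hω] at h2
    have : (s : ℝ) ≠ 0 := by positivity
    simp [this] at h2
  rcases hp.1.eq_or_lt with rfl | hp0
  · refine (measure_mono (t := ∅) ?_).trans (by simp)
    rintro ω ⟨s, _, _, _, h2, _⟩
    exact absurd (havg s ω).1 (not_le.2 h2)
  have hanti := antitoneOn_bernDiv_left hp0 hp1
  simp only [kl_eq_ofReal_bernDiv hp0 hp1]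
  rcases le_or_gt (bernDiv 0 p) z with hbig | hsmall
  · refine (measure_mono (t := ∅) ?_).trans (by simp)
    rintro ω ⟨s, _, _, _, h2, h3⟩
    have h4 := hanti (Set.left_mem_Icc.2 hp0.le) ⟨(havg s ω).1, h2.le⟩ (havg s ω).1
    exact absurd h3 (not_lt.2 (ENNReal.ofReal_le_ofReal (h4.trans hbig)))
  obtain ⟨x, hx, hxz⟩ := intermediate_value_Icc' hp0.le
    (continuous_bernDiv_left hp0 hp1).continuousOn ⟨(bernDiv_self p).le.trans hz.le, hsmall.le⟩
  simp only at hxz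
  have hx0 : 0 < x := hx.1.lt_of_ne fun h => by rw [← h] at hxz; linarith
  have hxp : x < p := hx.2.lt_of_ne fun h => by rw [h, bernDiv_self] at hxz; linarith
  have hx1 : 0 < 1 - x := by linarith
  have hp1' : 0 < 1 - p := by linarith
  set t := Real.log (x * (1 - p) / ((1 - x) * p)) with ht
  have htexp : Real.exp t = x * (1 - p) / ((1 - x) * p) := Real.exp_log (by positivity)
  have ht0 : t ≤ 0 := Real.log_nonpos (by positivity) <| by
    rw [div_le_one (by positivity)]; nlinarith
  have hψ : 1 - p + p * Real.exp t ≤ Real.exp (Real.log ((1 - p) / (1 - x))) := by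
    rw [htexp, Real.exp_log (by positivity)]
    refine le_of_eq ?_
    field_simp
    ring
  have hval : t * x - Real.log ((1 - p) / (1 - x)) = z := by
    rw [← hxz, bernDiv_eq hp0 hp1, ht, Real.log_div (by positivity) (by positivity),
      Real.log_mul hx0.ne' hp1'.ne', Real.log_mul hx1.ne' hp0.ne',
      Real.log_div hp1'.ne' hx1.ne']
    ring
  have hmain := h.measure_exists_le_sum_le (m := m) hψ (by rw [hval]; exact hz.le) N
  rw [hval] at hmain
  refine (measure_mono ?_).trans hmain
  rintro ω ⟨s, h1, h2, h3, h4, h5⟩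
  refine ⟨s, h1, h2, h3, ?_⟩
  have h6 : avg (fun i => Y i ω) s ≤ x := by
    by_contra! hlt
    have h7 := hanti hx ⟨(havg s ω).1, h4.le⟩ hlt.le
    simp only [hxz] at h7
    exact absurd h5 (not_lt.2 (ENNReal.ofReal_le_ofReal h7))
  rw [sum_eq_mul_avg _ h1, mul_left_comm t]
  exact mul_le_mul_of_nonneg_left (mul_le_mul_of_nonpos_left h6 ht0) (Nat.cast_nonneg _)

/-- The lower tail of the self-normalized deviation `s * kl (avg s) p`, by peeling: on the slab
`exp (i / f) ≤ s < exp ((i + 1) / f)` the uniform Chernoff bound loses only a factor `e`. -/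
theorem measure_exists_lt_mul_kl_le_of_lt (h : IsBernoulliSeq P p Y) {f : ℝ} (hf : 0 < f) (n : ℕ) :
    P {ω | ∃ s : ℕ, 1 ≤ s ∧ s ≤ n ∧ avg (fun i => Y i ω) s < p ∧
      ENNReal.ofReal f < s * CRS.kl (avg (fun i => Y i ω) s) p} ≤
      ENNReal.ofReal ((f * Real.log n + 1) * Real.exp (1 - f)) := by
  set I := ⌊f * Real.log n⌋₊ with hI
  have hlogn : 0 ≤ Real.log n := Real.log_natCast_nonneg n
  set A : ℕ → Set Ω := fun i => {ω | ∃ s : ℕ, 1 ≤ s ∧ s ≤ n ∧ Real.exp (i / f) ≤ s ∧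
    avg (fun i => Y i ω) s < p ∧
    ENNReal.ofReal (f * Real.exp (-((i + 1) / f))) < CRS.kl (avg (fun i => Y i ω) s) p} with hA
  have hsub : {ω | ∃ s : ℕ, 1 ≤ s ∧ s ≤ n ∧ avg (fun i => Y i ω) s < p ∧
      ENNReal.ofReal f < s * CRS.kl (avg (fun i => Y i ω) s) p} ⊆
      ⋃ i ∈ Finset.range (I + 1), A i := by
    rintro ω ⟨s, h1, h2, h3, h4⟩
    have hs : (0 : ℝ) < s := by exact_mod_cast h1
    have hlogs : 0 ≤ Real.log s := Real.log_natCast_nonneg s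
    refine Set.mem_iUnion₂.2 ⟨⌊f * Real.log s⌋₊, Finset.mem_range.2 ?_, s, h1, h2, ?_, h3, ?_⟩
    · refine Nat.lt_succ_of_le (Nat.floor_le_floor ?_)
      exact mul_le_mul_of_nonneg_left (Real.log_le_log hs (by exact_mod_cast h2)) hf.le
    · rw [← Real.le_log_iff_exp_le hs, div_le_iff₀ hf, mul_comm]
      exact Nat.floor_le (by positivity)
    · have h5 : (s : ℝ) ≤ Real.exp ((⌊f * Real.log s⌋₊ + 1) / f) := by
        rw [← Real.log_le_iff_le_exp hs, le_div_iff₀ hf, mul_comm]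
        exact (Nat.lt_floor_add_one _).le
      by_contra! hle
      refine absurd h4 (not_lt.2 ?_)
      calc (s : ℝ≥0∞) * CRS.kl (avg (fun i => Y i ω) s) p
          ≤ ENNReal.ofReal s * ENNReal.ofReal (f * Real.exp (-((⌊f * Real.log s⌋₊ + 1) / f))) := by
            rw [ENNReal.ofReal_natCast]; gcongr
        _ = ENNReal.ofReal (s * (f * Real.exp (-((⌊f * Real.log s⌋₊ + 1) / f)))) :=
            (ENNReal.ofReal_mul hs.le).symm
        _ ≤ ENNReal.ofReal f := by
            refine ENNReal.ofReal_le_ofReal ?_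
            rw [Real.exp_neg, mul_left_comm, ← div_eq_mul_inv]
            exact mul_le_of_le_one_right hf.le ((div_le_one (Real.exp_pos _)).2 h5)
  have hAi : ∀ i, P (A i) ≤ ENNReal.ofReal (Real.exp (1 - f)) := fun i => by
    refine (h.measure_exists_lt_kl_le (by positivity) (Real.exp (i / f)) n).trans
      (ENNReal.ofReal_le_ofReal (Real.exp_le_exp.2 ?_))
    have h1 : Real.exp (i / f) * (f * Real.exp (-((i + 1) / f))) = f * Real.exp (-(1 / f)) := by
      rw [mul_left_comm, ← Real.exp_add]; congr 2; ring
    have h2 := Real.add_one_le_exp (-(1 / f))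
    have h3 : f * (-(1 / f) + 1) = f - 1 := by field_simp; ring
    have h4 := mul_le_mul_of_nonneg_left h2 hf.le
    rw [h1]; linarith
  refine (measure_mono hsub).trans ((measure_biUnion_finset_le _ _).trans
    ((Finset.sum_le_sum fun i _ => hAi i).trans ?_))
  rw [Finset.sum_const, Finset.card_range, nsmul_eq_mul, ← ENNReal.ofReal_natCast,
    ← ENNReal.ofReal_mul (Nat.cast_nonneg _)]
  refine ENNReal.ofReal_le_ofReal (mul_le_mul_of_nonneg_right ?_ (Real.exp_pos _).le)
  push_cast
  linarith [Nat.floor_le (mul_nonneg hf.le hlogn)]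

end IsBernoulliSeq

/-- The exploration level `log n + 3 log log n` of the confidence intervals. -/
noncomputable def explor (n : ℕ) : ℝ := Real.log n + 3 * Real.log (Real.log n)

theorem one_lt_log_natCast {n : ℕ} (hn : 3 ≤ n) : 1 < Real.log n := by
  rw [Real.lt_log_iff_exp_lt (by positivity)]
  have h1 := Real.exp_one_lt_d9
  have h2 : (3 : ℝ) ≤ n := by exact_mod_cast hn
  linarith

theorem explor_pos {n : ℕ} (hn : 3 ≤ n) : 0 < explor n := by
  have h1 := one_lt_log_natCast hn
  have h2 := Real.log_pos h1
  unfold explor; linarith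

theorem explor_mono {m n : ℕ} (hm : 3 ≤ m) (hmn : m ≤ n) : explor m ≤ explor n := by
  have h1 := one_lt_log_natCast hm
  have h2 : Real.log m ≤ Real.log n :=
    Real.log_le_log (by positivity) (by exact_mod_cast hmn)
  have h3 := Real.log_le_log (by linarith) h2
  unfold explor; linarith

/-- The probability that the confidence interval at time `n` misses the mean, whatever the number
`s ≤ n` of observations, is `O (1 / (n log n))`. The term `3 log log n` of `explor n` pays for the
`O (log n ^ 2)` slabs of the peeling. -/
theorem IsBernoulliSeq.measure_exists_lt_mul_kl_le {Ω : Type*} [MeasurableSpace Ω] {P : Measure Ω}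
    [IsProbabilityMeasure P] {p : ℝ} {Y : ℕ → Ω → ℝ} (h : IsBernoulliSeq P p Y) {n : ℕ}
    (hn : 3 ≤ n) :
    P {ω | ∃ s : ℕ, 1 ≤ s ∧ s ≤ n ∧
      ENNReal.ofReal (explor n) < s * CRS.kl (avg (fun i => Y i ω) s) p} ≤
      ENNReal.ofReal (10 * Real.exp 1 / (n * Real.log n)) := by
  have hf := explor_pos hn
  have hlog := one_lt_log_natCast hn
  have hn0 : (0 : ℝ) < n := by positivity
  have hp := h.mean_mem_Icc
  have hbound : (explor n * Real.log n + 1) * Real.exp (1 - explor n) ≤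
      5 * Real.exp 1 / (n * Real.log n) := by
    have h1 : Real.exp (1 - explor n) = Real.exp 1 / (n * Real.log n ^ 3) := by
      have h2 : 3 * Real.log (Real.log n) = Real.log (Real.log n ^ 3) := by
        rw [Real.log_pow]; norm_num
      rw [explor, h2, Real.exp_sub, Real.exp_add, Real.exp_log hn0, Real.exp_log (by positivity)]
    have h3 : explor n ≤ 4 * Real.log n := by
      have := Real.log_le_sub_one_of_pos (by linarith : 0 < Real.log n)
      unfold explor; linarith
    have h4 : explor n * Real.log n + 1 ≤ 5 * Real.log n ^ 2 := by nlinarith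
    rw [h1]
    calc _ ≤ 5 * Real.log n ^ 2 * (Real.exp 1 / (n * Real.log n ^ 3)) :=
          mul_le_mul_of_nonneg_right h4 (by positivity)
      _ = _ := by field_simp
  have hside : ∀ {q : ℝ} {Z : ℕ → Ω → ℝ}, IsBernoulliSeq P q Z →
      P {ω | ∃ s : ℕ, 1 ≤ s ∧ s ≤ n ∧ avg (fun i => Z i ω) s < q ∧
        ENNReal.ofReal (explor n) < s * CRS.kl (avg (fun i => Z i ω) s) q} ≤
      ENNReal.ofReal (5 * Real.exp 1 / (n * Real.log n)) := fun hZ =>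
    (hZ.measure_exists_lt_mul_kl_le_of_lt hf n).trans (ENNReal.ofReal_le_ofReal hbound)
  have h10 : 10 * Real.exp 1 / (n * Real.log n) =
      5 * Real.exp 1 / (n * Real.log n) + 5 * Real.exp 1 / (n * Real.log n) := by ring
  rw [h10, ENNReal.ofReal_add (by positivity) (by positivity)]
  refine (measure_mono ?_).trans ((measure_union_le _ _).trans
    (add_le_add (hside h) (hside h.one_sub)))
  rintro ω ⟨s, h1, h2, h3⟩
  rcases lt_trichotomy (avg (fun i => Y i ω) s) p with hlt | heq | hgt
  · exact Or.inl ⟨s, h1, h2, hlt, h3⟩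
  · rw [heq, kl_self hp] at h3; simp at h3
  · refine Or.inr ⟨s, h1, h2, ?_, ?_⟩
    · rw [avg_one_sub _ h1]; linarith
    · rw [avg_one_sub _ h1, kl_one_sub]; exact h3

/-- The sum telescopes, by `1 / (n log n) ≤ log log n - log log (n - 1)`. -/
theorem sum_one_div_mul_log_le (T : ℕ) (hT : 2 ≤ T) :
    ∑ n ∈ Finset.Ico 3 (T + 1), 1 / ((n : ℝ) * Real.log n) ≤
      Real.log (Real.log T) - Real.log (Real.log 2) := by
  induction T, hT using Nat.le_induction with
  | base => simp
  | succ T hT ih =>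
    rw [Finset.sum_Ico_succ_top (by omega)]
    have hT0 : (0 : ℝ) < T := by positivity
    have hT2 : (2 : ℝ) ≤ T := by exact_mod_cast hT
    have ha : 0 < Real.log T := Real.log_pos (by linarith)
    have hb : 0 < Real.log (T + 1 : ℕ) := Real.log_pos (by push_cast; linarith)
    have h1 : 1 / ((T + 1 : ℕ) : ℝ) ≤ Real.log (T + 1 : ℕ) - Real.log T := by
      have := Real.one_sub_inv_le_log_of_pos (x := ((T + 1 : ℕ) : ℝ) / T) (by positivity)
      rw [Real.log_div (by positivity) hT0.ne'] at this
      refine le_trans (le_of_eq ?_) this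
      push_cast; field_simp; ring
    have h2 := Real.one_sub_inv_le_log_of_pos (x := Real.log (T + 1 : ℕ) / Real.log T)
      (by positivity)
    rw [Real.log_div hb.ne' ha.ne'] at h2
    have h3 : 1 / (((T + 1 : ℕ) : ℝ) * Real.log (T + 1 : ℕ)) ≤
        1 - (Real.log (T + 1 : ℕ) / Real.log T)⁻¹ := by
      have h4 : 1 - (Real.log (T + 1 : ℕ) / Real.log T)⁻¹ =
          (Real.log (T + 1 : ℕ) - Real.log T) / Real.log (T + 1 : ℕ) := by field_simp
      rw [h4, ← div_div]
      exact div_le_div_of_nonneg_right h1 hb.le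
    linarith

theorem sum_exp_neg_mul_le {b : ℝ} (hb : 0 < b) (N : ℕ) :
    ∑ s ∈ Finset.range N, Real.exp (-(s * b)) ≤ 1 + 1 / b := by
  have h1 : ∀ s : ℕ, Real.exp (-(s * b)) = Real.exp (-b) ^ s := fun s => by
    rw [← Real.exp_nat_mul]; ring_nf
  simp_rw [h1]
  have h0 := Real.exp_pos (-b)
  have hlt : Real.exp (-b) < 1 := by
    rw [← Real.exp_zero]; exact Real.exp_lt_exp.2 (by linarith)
  have h2 : ∑ s ∈ Finset.range N, Real.exp (-b) ^ s ≤ (1 - Real.exp (-b))⁻¹ := by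
    rw [← tsum_geometric_of_lt_one h0.le hlt]
    exact (summable_geometric_of_lt_one h0.le hlt).sum_le_tsum _ fun _ _ => by positivity
  refine h2.trans ?_
  have h3 : Real.exp (-b) ≤ (1 + b)⁻¹ := by
    rw [Real.exp_neg]
    exact inv_anti₀ (by linarith) (by linarith [Real.add_one_le_exp b])
  have h4 : b / (1 + b) ≤ 1 - Real.exp (-b) := by
    have : b / (1 + b) = 1 - (1 + b)⁻¹ := by field_simp; ring
    linarith
  calc (1 - Real.exp (-b))⁻¹ ≤ (b / (1 + b))⁻¹ := inv_anti₀ (by positivity) h4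
    _ = 1 + 1 / b := by field_simp; ring

/-! ### Throughputs, gaps and statistics of a trajectory -/

theorem rateDist_self {K : ℕ} (k : Fin K) : CRS.rateDist k k = 0 := by simp [CRS.rateDist]

theorem rateDist_eq_one_iff {K : ℕ} (k k' : Fin K) :
    CRS.rateDist k k' = 1 ↔ (k : ℕ) = k' + 1 ∨ (k' : ℕ) = k + 1 := by
  unfold CRS.rateDist
  constructor
  · intro h
    rcases abs_eq (by norm_num : (0 : ℤ) ≤ 1) |>.1 h with h | h <;> omega
  · rintro (h | h)
    · rw [h]; push_cast; simp
    · rw [h]; push_cast; simp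

theorem exists_rateDist_eq_one {K : ℕ} (hK : 2 ≤ K) (k : Fin K) :
    ∃ k', CRS.rateDist k' k = 1 := by
  simp_rw [rateDist_eq_one_iff]
  rcases Nat.eq_zero_or_pos (k : ℕ) with h | h
  · exact ⟨⟨1, by omega⟩, Or.inl (by simp [h])⟩
  · exact ⟨⟨k - 1, by omega⟩, Or.inr (by simp only; omega)⟩

section Instance

variable {C K : ℕ} {r : Fin K → ℝ} {θ : Fin C → Fin K → ℝ}

theorem strictMonoOn_thr_and_strictAntiOn_thr (hθ : ∀ c, θ c ∈ CRS.unimodalSet r) {kb : Fin C → Fin K}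
    (hkb : ∀ c, CRS.IsBestRate r θ c (kb c)) (c : Fin C) :
    StrictMonoOn (fun k => CRS.thr r θ c k) (Set.Iic (kb c)) ∧
      StrictAntiOn (fun k => CRS.thr r θ c k) (Set.Ici (kb c)) := by
  obtain ⟨_, k₁, h1, h2⟩ := hθ c
  have : kb c = k₁ := by
    by_contra hne
    have h3 := hkb c k₁ (Ne.symm hne)
    rcases lt_or_gt_of_ne hne with h | h
    · exact absurd h3 (not_lt.2 (h1 (Set.mem_Iic.2 h.le) (Set.mem_Iic.2 le_rfl) h).le)
    · exact absurd h3 (not_lt.2 (h2 (Set.mem_Ici.2 le_rfl) (Set.mem_Ici.2 h.le) h).le)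
  rw [this]
  exact ⟨h1, h2⟩

theorem exists_better_neighbour (hθ : ∀ c, θ c ∈ CRS.unimodalSet r) {kb : Fin C → Fin K}
    (hkb : ∀ c, CRS.IsBestRate r θ c (kb c)) (c : Fin C) {l : Fin K} (hl : l ≠ kb c) :
    ∃ k, CRS.rateDist k l = 1 ∧ CRS.thr r θ c l < CRS.thr r θ c k := by
  obtain ⟨h1, h2⟩ := strictMonoOn_thr_and_strictAntiOn_thr hθ hkb c
  rcases lt_or_gt_of_ne hl with h | h
  · have h' : (l : ℕ) < kb c := h
    refine ⟨⟨l + 1, by omega⟩, (rateDist_eq_one_iff _ _).2 (Or.inl rfl),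
      h1 (Set.mem_Iic.2 h.le) (Set.mem_Iic.2 ?_) ?_⟩
    · exact Fin.le_def.2 (by simp only; omega)
    · exact Fin.lt_def.2 (by simp)
  · have h' : (kb c : ℕ) < l := h
    refine ⟨⟨l - 1, by omega⟩, (rateDist_eq_one_iff _ _).2 (Or.inr (by simp only; omega)),
      h2 (Set.mem_Ici.2 ?_) (Set.mem_Ici.2 h.le) ?_⟩
    · exact Fin.le_def.2 (by simp only; omega)
    · exact Fin.lt_def.2 (by simp only; omega)

theorem thr_ne_of_rateDist (hθ : ∀ c, θ c ∈ CRS.unimodalSet r) {kb : Fin C → Fin K}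
    (hkb : ∀ c, CRS.IsBestRate r θ c (kb c)) (c : Fin C) {k k' : Fin K}
    (h : CRS.rateDist k' k = 1) : CRS.thr r θ c k ≠ CRS.thr r θ c k' := by
  obtain ⟨h1, h2⟩ := strictMonoOn_thr_and_strictAntiOn_thr hθ hkb c
  have key : ∀ i j : Fin K, (j : ℕ) = i + 1 → CRS.thr r θ c i ≠ CRS.thr r θ c j := fun i j hij => by
    rcases le_or_gt j (kb c) with hj | hj
    · have hi : i ≤ kb c := Fin.le_def.2 (by have := Fin.le_def.1 hj; omega)
      exact (h1 (Set.mem_Iic.2 hi) (Set.mem_Iic.2 hj) (Fin.lt_def.2 (by omega))).ne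
    · have hi : kb c ≤ i := Fin.le_def.2 (by have := Fin.lt_def.1 hj; omega)
      exact (h2 (Set.mem_Ici.2 hi) (Set.mem_Ici.2 hj.le) (Fin.lt_def.2 (by omega))).ne'
  rcases (rateDist_eq_one_iff _ _).1 h with h | h
  · exact key k k' h
  · exact (key k' k h).symm

theorem minGap_le {c : Fin C} {k k' : Fin K} (h : CRS.rateDist k' k = 1) :
    CRS.minGap r θ ≤ |CRS.thr r θ c k - CRS.thr r θ c k'| :=
  csInf_le ⟨0, by rintro d ⟨_, _, _, _, rfl⟩; exact abs_nonneg _⟩ ⟨c, k, k', h, rfl⟩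

theorem minGap_pos (hK : 2 ≤ K) (hθ : ∀ c, θ c ∈ CRS.unimodalSet r) {kb : Fin C → Fin K}
    (hkb : ∀ c, CRS.IsBestRate r θ c (kb c)) (c₀ : Fin C) : 0 < CRS.minGap r θ := by
  have hfin : {d | ∃ c k k', CRS.rateDist k' k = 1 ∧
      d = |CRS.thr r θ c k - CRS.thr r θ c k'|}.Finite := by
    refine (Set.finite_range fun t : Fin C × Fin K × Fin K =>
      |CRS.thr r θ t.1 t.2.1 - CRS.thr r θ t.1 t.2.2|).subset ?_
    rintro d ⟨c, k, k', _, rfl⟩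
    exact ⟨(c, k, k'), rfl⟩
  obtain ⟨k', hk'⟩ := exists_rateDist_eq_one hK (kb c₀)
  have hne : {d | ∃ c k k', CRS.rateDist k' k = 1 ∧
      d = |CRS.thr r θ c k - CRS.thr r θ c k'|}.Nonempty := ⟨_, c₀, kb c₀, k', hk', rfl⟩
  obtain ⟨c, k, k', h, heq⟩ := hne.csInf_mem hfin
  unfold CRS.minGap
  rw [heq]
  exact abs_pos.2 (sub_ne_zero.2 (thr_ne_of_rateDist hθ hkb c h))

/-- `midThr` is at distance at least `Δ / 2` from the throughputs of the best rate and of its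
neighbours. -/
theorem midThr_bounds (hK : 2 ≤ K) {kb : Fin C → Fin K}
    (hkb : ∀ c, CRS.IsBestRate r θ c (kb c)) (c : Fin C) :
    CRS.midThr r θ c (kb c) + CRS.minGap r θ / 2 ≤ CRS.thr r θ c (kb c) ∧
      ∀ k, CRS.rateDist k (kb c) = 1 →
        CRS.thr r θ c k + CRS.minGap r θ / 2 ≤ CRS.midThr r θ c (kb c) := by
  have hfin : {m | ∃ k, CRS.rateDist k (kb c) = 1 ∧ m = CRS.thr r θ c k}.Finite := by
    refine (Set.finite_range fun k => CRS.thr r θ c k).subset ?_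
    rintro d ⟨k, _, rfl⟩
    exact ⟨k, rfl⟩
  obtain ⟨k', hk'⟩ := exists_rateDist_eq_one hK (kb c)
  have hne : {m | ∃ k, CRS.rateDist k (kb c) = 1 ∧ m = CRS.thr r θ c k}.Nonempty :=
    ⟨_, k', hk', rfl⟩
  obtain ⟨k₀, h₀, heq⟩ := hne.csSup_mem hfin
  have hne : k₀ ≠ kb c := by
    rintro rfl; rw [rateDist_self] at h₀; exact absurd h₀ (by norm_num)
  have hgap := minGap_le (r := r) (θ := θ) (c := c) h₀
  rw [abs_of_pos (sub_pos.2 (hkb c k₀ hne))] at hgap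
  unfold CRS.midThr
  rw [heq]
  refine ⟨by linarith, fun k hk => ?_⟩
  have h1 : CRS.thr r θ c k ≤ CRS.thr r θ c k₀ := by
    rw [← heq]; exact le_csSup hfin.bddAbove ⟨k, hk, rfl⟩
  linarith

theorem best_rate_eq {cs : Fin C} {ks : Fin K} (hbest : CRS.IsBestPair r θ cs ks)
    {kb : Fin C → Fin K} (hkb : ∀ c, CRS.IsBestRate r θ c (kb c)) : kb cs = ks := by
  by_contra h
  exact lt_asymm (hbest cs (kb cs) fun he => h (congrArg Prod.snd he)) (hkb cs ks (Ne.symm h))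

theorem tau_le_kl_mid {cs : Fin C} {ks : Fin K} {c : Fin C} {kc k : Fin K}
    (h : CRS.rateDist k kc ≤ 1) :
    CRS.tau r θ cs ks c kc ≤ CRS.kl (θ c k) (CRS.midThr r θ c kc / r k) :=
  (min_le_left _ _).trans (iInf₂_le k h)

theorem tau_le_kl_best {cs : Fin C} {ks : Fin K} {c : Fin C} {kc : Fin K} (h : c ≠ cs) :
    CRS.tau r θ cs ks c kc ≤ CRS.kl (θ c kc) (CRS.thr r θ cs ks / r kc) :=
  (min_le_right _ _).trans (iInf_le _ h)

theorem tau_pos (hK : 2 ≤ K) (hr0 : ∀ k, 0 < r k) (hθ : ∀ c, θ c ∈ CRS.unimodalSet r)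
    {cs : Fin C} {ks : Fin K} (hbest : CRS.IsBestPair r θ cs ks)
    {kb : Fin C → Fin K} (hkb : ∀ c, CRS.IsBestRate r θ c (kb c)) (c : Fin C) :
    0 < CRS.tau r θ cs ks c (kb c) := by
  have hΔ := minGap_pos hK hθ hkb c
  obtain ⟨hm1, hm2⟩ := midThr_bounds hK hkb c
  refine lt_min ?_ ?_
  · have : Nonempty (Fin K) := ⟨kb c⟩
    obtain ⟨k, hk⟩ := exists_eq_ciInf_of_finite (f := fun k : Fin K =>
      ⨅ _ : CRS.rateDist k (kb c) ≤ 1, CRS.kl (θ c k) (CRS.midThr r θ c (kb c) / r k))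
    rw [← hk]
    by_cases hk : CRS.rateDist k (kb c) ≤ 1
    swap
    · simp [hk]
    rw [iInf_pos hk]
    refine kl_pos ((hθ c).1 k) fun h => ?_
    have h1 : CRS.thr r θ c k = CRS.midThr r θ c (kb c) := by
      rw [CRS.thr, h, mul_div_cancel₀ _ (hr0 k).ne']
    rcases eq_or_ne k (kb c) with rfl | hne
    · linarith
    · have h2 : CRS.rateDist k (kb c) = 1 := by
        refine le_antisymm hk ?_
        unfold CRS.rateDist
        refine Int.one_le_abs fun h => hne (Fin.ext ?_)
        omega
      linarith [hm2 k h2]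
  · by_cases hc : c = cs
    · simp [hc]
    rw [iInf_pos hc]
    refine kl_pos ((hθ c).1 _) fun h => ?_
    have h1 : CRS.thr r θ c (kb c) = CRS.thr r θ cs ks := by
      rw [CRS.thr, h, mul_div_cancel₀ _ (hr0 _).ne']
    exact absurd (hbest c (kb c) fun he => hc (congrArg Prod.fst he)) (by rw [h1]; exact lt_irrefl _)

theorem crsConst_ne_top (hK : 2 ≤ K) (hr0 : ∀ k, 0 < r k) (hθ : ∀ c, θ c ∈ CRS.unimodalSet r)
    {cs : Fin C} {ks : Fin K} (hbest : CRS.IsBestPair r θ cs ks)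
    {kb : Fin C → Fin K} (hkb : ∀ c, CRS.IsBestRate r θ c (kb c)) :
    CRS.crsConst r θ cs ks kb ≠ ⊤ := by
  refine ENNReal.sum_ne_top.2 fun c _ => ENNReal.mul_ne_top ?_ ?_
  · exact ENNReal.inv_ne_top.2 (tau_pos hK hr0 hθ hbest hkb c).ne'
  · exact ENNReal.sum_ne_top.2 fun _ _ => ENNReal.ofReal_ne_top

end Instance

section Trajectory

variable {C K : ℕ} {r : Fin K → ℝ} {x : Fin C → Fin K → ℕ → ℝ} {a : ℕ → Fin C × Fin K}

theorem pulls_le (a : ℕ → Fin C × Fin K) (n : ℕ) (c : Fin C) (k : Fin K) :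
    CRS.pulls a n c k ≤ n :=
  (Finset.card_filter_le _ _).trans (Finset.card_range n).le

theorem pulls_succ (a : ℕ → Fin C × Fin K) (n : ℕ) (c : Fin C) (k : Fin K) :
    CRS.pulls a (n + 1) c k = CRS.pulls a n c k + if a n = (c, k) then 1 else 0 := by
  unfold CRS.pulls
  rw [Finset.range_add_one, Finset.filter_insert]
  split_ifs with h
  · rw [Finset.card_insert_of_notMem (by simp)]
  · rfl

/-- Distinct selections of a pair happen at distinct values of its number of selections. -/
theorem sum_ite_selected (a : ℕ → Fin C × Fin K) (c : Fin C) (k : Fin K) (g : ℕ → ℝ) (T : ℕ) :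
    ∑ n ∈ Finset.range T, (if a n = (c, k) then g (CRS.pulls a n c k) else 0) =
      ∑ s ∈ Finset.range (CRS.pulls a T c k), g s := by
  induction T with
  | zero => simp [CRS.pulls]
  | succ T ih =>
    rw [Finset.sum_range_succ, ih, pulls_succ]
    split_ifs with h
    · rw [Finset.sum_range_succ]
    · simp

theorem one_le_pulls (ha : CRS.IsCRST r x a) {n : ℕ} (hn : C * K ≤ n) (c : Fin C) (k : Fin K) :
    1 ≤ CRS.pulls a n c k := by
  have hk := k.2
  have hlt : (c : ℕ) * K + k < C * K := by
    calc (c : ℕ) * K + k < c * K + K := by omega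
      _ = (c + 1) * K := by ring
      _ ≤ C * K := Nat.mul_le_mul_right _ c.2
  obtain ⟨h1, h2⟩ := ha.init _ hlt
  have hK : 0 < K := by omega
  refine Finset.card_pos.2 ⟨c * K + k, Finset.mem_filter.2 ⟨Finset.mem_range.2 (by omega), ?_⟩⟩
  refine Prod.ext (Fin.ext ?_) (Fin.ext ?_)
  · rw [h1, mul_comm, Nat.mul_add_div hK, Nat.div_eq_of_lt hk, add_zero]
  · rw [h2, mul_comm, Nat.mul_add_mod, Nat.mod_eq_of_lt hk]

theorem empThr_eq (r : Fin K → ℝ) (x : Fin C → Fin K → ℕ → ℝ) (a : ℕ → Fin C × Fin K) (n : ℕ)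
    (c : Fin C) (k : Fin K) :
    CRS.empThr r x a n c k = r k * avg (x c k) (CRS.pulls a n c k) := by
  rw [CRS.empThr, avg, ← Finset.mul_sum, mul_div_assoc]

theorem mem_confSet_iff (hr0 : ∀ k, 0 < r k) {n : ℕ} {c : Fin C} {k : Fin K} {q : ℝ} :
    q ∈ CRS.confSet r x a n c k ↔ q ∈ Set.Icc 0 (r k) ∧
      (CRS.pulls a n c k : ℝ≥0∞) * CRS.kl (avg (x c k) (CRS.pulls a n c k)) (q / r k) ≤
        ENNReal.ofReal (explor n) := by
  rw [CRS.confSet, Set.mem_ofPred_eq, empThr_eq, mul_div_cancel_left₀ _ (hr0 k).ne']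
  rfl

theorem confSet_bddAbove {n : ℕ} {c : Fin C} {k : Fin K} : BddAbove (CRS.confSet r x a n c k) :=
  ⟨r k, fun _ h => h.1.2⟩

theorem confSet_bddBelow {n : ℕ} {c : Fin C} {k : Fin K} : BddBelow (CRS.confSet r x a n c k) :=
  ⟨0, fun _ h => h.1.1⟩

theorem confSet_nonempty (hr0 : ∀ k, 0 < r k) (hx : ∀ c k i, x c k i = 0 ∨ x c k i = 1) {n : ℕ}
    {c : Fin C} {k : Fin K} : (CRS.confSet r x a n c k).Nonempty := by
  have havg := avg_mem_Icc (hx c k) (CRS.pulls a n c k)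
  refine ⟨r k * avg (x c k) (CRS.pulls a n c k), (mem_confSet_iff hr0).2 ⟨⟨mul_nonneg (hr0 k).le
    havg.1, mul_le_of_le_one_right (hr0 k).le havg.2⟩, ?_⟩⟩
  rw [mul_div_cancel_left₀ _ (hr0 k).ne', kl_self havg]
  simp

/-- The upper confidence bound is attained. -/
theorem ucb_mem_confSet (hr0 : ∀ k, 0 < r k) (hx : ∀ c k i, x c k i = 0 ∨ x c k i = 1) {n : ℕ}
    (hn : 3 ≤ n) {c : Fin C} {k : Fin K} (ht : 1 ≤ CRS.pulls a n c k) :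
    CRS.ucb r x a n c k ∈ CRS.confSet r x a n c k := by
  have havg := avg_mem_Icc (hx c k) (CRS.pulls a n c k)
  have ht0 : (0 : ℝ) < CRS.pulls a n c k := by exact_mod_cast ht
  have hf := explor_pos hn
  have hrk := hr0 k
  have hset : CRS.confSet r x a n c k = (fun q => q / r k) ⁻¹' {q | q ∈ Set.Icc (0 : ℝ) 1 ∧
      CRS.kl (avg (x c k) (CRS.pulls a n c k)) q ≤
        ENNReal.ofReal (explor n / CRS.pulls a n c k)} := by
    ext q
    rw [mem_confSet_iff hr0, Set.mem_preimage, Set.mem_ofPred_eq, Set.mem_Icc, Set.mem_Icc,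
      ENNReal.ofReal_div_of_pos ht0, ENNReal.ofReal_natCast,
      ENNReal.le_div_iff_mul_le (Or.inl (by simp; omega)) (Or.inl (by simp)), mul_comm,
      div_le_one hrk, le_div_iff₀ hrk, zero_mul]
  have hclosed : IsClosed (CRS.confSet r x a n c k) := by
    rw [hset]
    exact (isClosed_setOf_kl_le havg (by positivity)).preimage (by fun_prop)
  exact hclosed.csSup_mem (confSet_nonempty hr0 hx) confSet_bddAbove

end Trajectory

/-! ### Causes of a selection -/

theorem IsKLFraction.up {ε l : ℝ} (h : IsKLFraction ε l) (hl1 : l < 1) {p q q' y : ℝ}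
    {t F : ℝ≥0∞} (hp : 0 ≤ p) (hpq : p < q) (hqq' : q ≤ q') (hq' : q' ≤ 1) (hy : 0 ≤ y)
    (hF : t * CRS.kl y q' ≤ F) :
    p + l * (q - p) ≤ y ∨ t * CRS.kl p q ≤ ENNReal.ofReal (1 + ε) * F := by
  rcases le_or_gt (p + l * (q - p)) y with h1 | h1
  · exact Or.inl h1
  have hyq : y ≤ q := by nlinarith
  refine Or.inr ?_
  calc t * CRS.kl p q ≤ t * (ENNReal.ofReal (1 + ε) * CRS.kl y q') := by
        gcongr
        exact (h p q y hp hpq (hqq'.trans hq') hy h1.le).trans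
          (by gcongr; exact kl_mono_right hy hyq hqq')
    _ = ENNReal.ofReal (1 + ε) * (t * CRS.kl y q') := mul_left_comm _ _ _
    _ ≤ _ := by gcongr

theorem IsKLFraction.down {ε l : ℝ} (h : IsKLFraction ε l) (hl1 : l < 1) {p q q' y : ℝ}
    {t F : ℝ≥0∞} (hp : p ≤ 1) (hpq : q < p) (hqq' : q' ≤ q) (hq' : 0 ≤ q') (hy : y ≤ 1)
    (hF : t * CRS.kl y q' ≤ F) :
    y ≤ p - l * (p - q) ∨ t * CRS.kl p q ≤ ENNReal.ofReal (1 + ε) * F := by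
  rw [← kl_one_sub] at hF
  rcases h.up hl1 (p := 1 - p) (q := 1 - q) (q' := 1 - q') (y := 1 - y) (by linarith)
    (by linarith) (by linarith) (by linarith) (by linarith) hF with h1 | h1
  · left; linarith
  · right; rwa [kl_one_sub] at h1

section Step

variable {C K : ℕ} {r : Fin K → ℝ} {θ : Fin C → Fin K → ℝ} {x : Fin C → Fin K → ℕ → ℝ}
  {a : ℕ → Fin C × Fin K}

theorem thr_mem_confSet (hr0 : ∀ k, 0 < r k) (hθ : ∀ c k, θ c k ∈ Set.Icc (0 : ℝ) 1) {n : ℕ}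
    {c : Fin C} {k : Fin K}
    (hgood : (CRS.pulls a n c k : ℝ≥0∞) * CRS.kl (avg (x c k) (CRS.pulls a n c k)) (θ c k) ≤
      ENNReal.ofReal (explor n)) : CRS.thr r θ c k ∈ CRS.confSet r x a n c k := by
  rw [mem_confSet_iff hr0, CRS.thr, mul_div_cancel_left₀ _ (hr0 k).ne']
  exact ⟨⟨mul_nonneg (hr0 k).le (hθ c k).1, mul_le_of_le_one_right (hr0 k).le (hθ c k).2⟩, hgood⟩

/-- If a channel passes its test while all confidence intervals are correct, its leader is its
best rate: otherwise some neighbour of the leader would be strictly better. -/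
theorem leader_eq_of_testPassed (hr0 : ∀ k, 0 < r k) (hθ : ∀ c, θ c ∈ CRS.unimodalSet r)
    {kb : Fin C → Fin K} (hkb : ∀ c, CRS.IsBestRate r θ c (kb c)) {n : ℕ}
    (hgood : ∀ c k, (CRS.pulls a n c k : ℝ≥0∞) *
      CRS.kl (avg (x c k) (CRS.pulls a n c k)) (θ c k) ≤ ENNReal.ofReal (explor n))
    {c : Fin C} {l : Fin K} (h : CRS.TestPassed r x a n c l) : l = kb c := by
  by_contra hne
  obtain ⟨k, hk, hlt⟩ := exists_better_neighbour hθ hkb c hne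
  have hmem := fun k => thr_mem_confSet hr0 (fun c => (hθ c).1) (hgood c k)
  have h1 : CRS.thr r θ c k ≤ CRS.ucb r x a n c k := le_csSup confSet_bddAbove (hmem k)
  have h2 : CRS.lcb r x a n c l ≤ CRS.thr r θ c l := csInf_le confSet_bddBelow (hmem l)
  linarith [h k hk]

/-- A wrong leader means that the empirical throughput of the leader, or of a strictly better
neighbour, is off by at least `Δ / 2`. -/
theorem exists_deviation_of_isLeader (hθ : ∀ c, θ c ∈ CRS.unimodalSet r)
    {kb : Fin C → Fin K} (hkb : ∀ c, CRS.IsBestRate r θ c (kb c)) {n : ℕ}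
    {c : Fin C} {l : Fin K} (hl : CRS.IsLeader r x a n c l) (hne : l ≠ kb c) :
    ∃ j, CRS.rateDist j l ≤ 1 ∧
      CRS.minGap r θ / 2 ≤ |r j * avg (x c j) (CRS.pulls a n c j) - r j * θ c j| := by
  obtain ⟨k, hk, hlt⟩ := exists_better_neighbour hθ hkb c hne
  have hgap := minGap_le (r := r) (θ := θ) (c := c) hk
  rw [abs_sub_comm, abs_of_pos (sub_pos.2 hlt)] at hgap
  have h1 := hl k
  rw [empThr_eq, empThr_eq] at h1
  unfold CRS.thr at hgap
  by_contra! hcon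
  have h2 := abs_lt.1 (hcon k hk.le)
  have h3 := abs_lt.1 (hcon l (by rw [rateDist_self]; norm_num))
  linarith [h2.1, h3.2]

/-- If the test of a channel fails while its leader is its best rate, then the average of some
rate `j` near the leader has moved a fraction of the way to `midThr`, or `j` has been selected
only a logarithmic number of times. -/
theorem deviation_or_le_of_not_testPassed {ε l : ℝ} (hl : IsKLFraction ε l) (hl0 : 0 < l)
    (hl1 : l < 1) (hK : 2 ≤ K) (hr0 : ∀ k, 0 < r k) (hθ : ∀ c, θ c ∈ CRS.unimodalSet r)
    {kb : Fin C → Fin K} (hkb : ∀ c, CRS.IsBestRate r θ c (kb c))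
    (hx : ∀ c k i, x c k i = 0 ∨ x c k i = 1) {n : ℕ} {c : Fin C}
    (h : ¬ CRS.TestPassed r x a n c (kb c)) :
    ∃ j, CRS.rateDist j (kb c) ≤ 1 ∧
      (l * (CRS.minGap r θ / 2) ≤ |r j * avg (x c j) (CRS.pulls a n c j) - r j * θ c j| ∨
      (CRS.pulls a n c j : ℝ≥0∞) * CRS.kl (θ c j) (CRS.midThr r θ c (kb c) / r j) ≤
        ENNReal.ofReal (1 + ε) * ENNReal.ofReal (explor n)) := by
  have hΔ := minGap_pos hK hθ hkb c
  obtain ⟨hm1, hm2⟩ := midThr_bounds hK hkb c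
  set mid := CRS.midThr r θ c (kb c) with hmid
  have havg := fun k => avg_mem_Icc (hx c k) (CRS.pulls a n c k)
  have hth := (hθ c).1
  unfold CRS.TestPassed at h
  push Not at h
  obtain ⟨k, hk, hlt⟩ := h
  rcases lt_or_ge (CRS.lcb r x a n c (kb c)) mid with hlow | hlow
  · refine ⟨kb c, by rw [rateDist_self]; norm_num, ?_⟩
    have hrk := hr0 (kb c)
    obtain ⟨q', hq', hq'mid⟩ := exists_lt_of_csInf_lt (confSet_nonempty hr0 hx) hlow
    rw [mem_confSet_iff hr0] at hq'
    have hpq : mid / r (kb c) < θ c (kb c) := by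
      rw [div_lt_iff₀ hrk, mul_comm]; unfold CRS.thr at hm1; linarith
    refine (hl.down hl1 (hth _).2 hpq (div_le_div_of_nonneg_right hq'mid.le hrk.le)
      (div_nonneg hq'.1.1 hrk.le) (havg _).2 hq'.2).imp_left fun h1 => ?_
    have h2 := mul_le_mul_of_nonneg_left h1 hrk.le
    have h3 : r (kb c) * (θ c (kb c) - l * (θ c (kb c) - mid / r (kb c))) =
        r (kb c) * θ c (kb c) - l * (r (kb c) * θ c (kb c) - mid) := by field_simp
    rw [h3] at h2
    have h4 : l * (CRS.minGap r θ / 2) ≤ l * (r (kb c) * θ c (kb c) - mid) := by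
      refine mul_le_mul_of_nonneg_left ?_ hl0.le
      unfold CRS.thr at hm1; linarith
    exact le_trans (by linarith) (neg_le_abs _)
  · refine ⟨k, hk.le, ?_⟩
    have hrk := hr0 k
    obtain ⟨q', hq', hq'mid⟩ := exists_lt_of_lt_csSup (confSet_nonempty hr0 hx)
      (hlow.trans_lt hlt)
    rw [mem_confSet_iff hr0] at hq'
    have hm2 := hm2 k hk
    have hpq : θ c k < mid / r k := by
      rw [lt_div_iff₀ hrk, mul_comm]; unfold CRS.thr at hm2; linarith
    refine (hl.up hl1 (hth _).1 hpq (div_le_div_of_nonneg_right hq'mid.le hrk.le)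
      ((div_le_one hrk).2 hq'.1.2) (havg _).1 hq'.2).imp_left fun h1 => ?_
    have h2 := mul_le_mul_of_nonneg_left h1 hrk.le
    have h3 : r k * (θ c k + l * (mid / r k - θ c k)) =
        r k * θ c k + l * (mid - r k * θ c k) := by field_simp
    rw [h3] at h2
    have h4 : l * (CRS.minGap r θ / 2) ≤ l * (mid - r k * θ c k) := by
      refine mul_le_mul_of_nonneg_left ?_ hl0.le
      unfold CRS.thr at hm2; linarith
    exact le_trans (by linarith) (le_abs_self _)

/-- What a selection made while all confidence intervals are correct can be due to: a deviation
of order `Δ` of some rate of the selected channel, at a time when that rate was selected at least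
as often as the selected one; a logarithmic number of selections of a rate near the best one; a
deviation of the best rate of a suboptimal channel towards the best throughput; or the selected
pair is the best one. -/
theorem selection_cases {ε l : ℝ} (hε : 0 < ε) (hl : IsKLFraction ε l) (hl0 : 0 < l) (hl1 : l < 1)
    (hK : 2 ≤ K) (hr0 : ∀ k, 0 < r k) (hθ : ∀ c, θ c ∈ CRS.unimodalSet r) {cs : Fin C}
    {ks : Fin K} (hbest : CRS.IsBestPair r θ cs ks) {kb : Fin C → Fin K}
    (hkb : ∀ c, CRS.IsBestRate r θ c (kb c)) (hx : ∀ c k i, x c k i = 0 ∨ x c k i = 1)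
    (ha : CRS.IsCRST r x a) {n : ℕ} (hn3 : 3 ≤ n) (hn : C * K ≤ n)
    (hgood : ∀ c k, (CRS.pulls a n c k : ℝ≥0∞) *
      CRS.kl (avg (x c k) (CRS.pulls a n c k)) (θ c k) ≤ ENNReal.ofReal (explor n))
    {c : Fin C} {k : Fin K} (hck : a n = (c, k)) :
    (∃ j, ∃ s, 1 ≤ s ∧ CRS.pulls a n c k ≤ s ∧ s ≤ n ∧
      l * (CRS.minGap r θ / 2) ≤ |r j * avg (x c j) s - r j * θ c j|) ∨
    (CRS.rateDist k (kb c) ≤ 1 ∧ (CRS.pulls a n c k : ℝ≥0∞) ≤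
      ENNReal.ofReal ((1 + ε) * explor n) * (CRS.tau r θ cs ks c (kb c))⁻¹) ∨
    (c ≠ cs ∧ k = kb c ∧ CRS.thr r θ cs ks ≤ r k ∧ ∃ s, 1 ≤ s ∧ CRS.pulls a n c k ≤ s ∧ s ≤ n ∧
      θ c k + l * (CRS.thr r θ cs ks / r k - θ c k) ≤ avg (x c k) s) ∨
    (c = cs ∧ k = ks) := by
  have hΔ := minGap_pos hK hθ hkb c
  have hf := explor_pos hn3
  have hpull := one_le_pulls ha hn
  have hτ := tau_pos hK hr0 hθ hbest hkb c
  -- the form in which the logarithmic bound on the number of selections is obtained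
  have hlog : ∀ t : ℕ, (t : ℝ≥0∞) * CRS.tau r θ cs ks c (kb c) ≤
      ENNReal.ofReal (1 + ε) * ENNReal.ofReal (explor n) →
      (t : ℝ≥0∞) ≤ ENNReal.ofReal ((1 + ε) * explor n) * (CRS.tau r θ cs ks c (kb c))⁻¹ :=
    fun t ht => by
      rw [← div_eq_mul_inv, ENNReal.le_div_iff_mul_le (Or.inl hτ.ne') (Or.inr ENNReal.ofReal_ne_top),
        ENNReal.ofReal_mul (by linarith)]
      exact ht
  obtain ⟨L, hL, hfail, hpass⟩ := ha.step n hn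
  rw [hck] at hfail hpass
  by_cases hU : ∃ c, ¬ CRS.TestPassed r x a n c (L c)
  · obtain ⟨htest, hnear, hmin⟩ := hfail hU
    simp only at htest hnear hmin
    by_cases hLc : L c = kb c
    · rw [hLc] at htest hnear hmin
      obtain ⟨j, hj, h1 | h1⟩ :=
        deviation_or_le_of_not_testPassed hl hl0 hl1 hK hr0 hθ hkb hx htest
      · exact Or.inl ⟨j, _, hpull c j, hmin j hj, pulls_le _ _ _ _, h1⟩
      · refine Or.inr (Or.inl ⟨hnear, hlog _ (le_trans ?_ h1)⟩)
        gcongr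
        · exact hmin j hj
        · exact tau_le_kl_mid hj
    · obtain ⟨j, hj, h1⟩ := exists_deviation_of_isLeader hθ hkb (hL c) hLc
      refine Or.inl ⟨j, _, hpull c j, hmin j hj, pulls_le _ _ _ _, le_trans ?_ h1⟩
      exact mul_le_of_le_one_left (by positivity) hl1.le
  · push Not at hU
    have hidx := hpass hU
    simp only at hidx
    have hLc : ∀ c, L c = kb c := fun c => leader_eq_of_testPassed hr0 hθ hkb hgood (hU c)
    have hks := best_rate_eq hbest hkb
    have hucb : CRS.thr r θ cs ks ≤ CRS.ucb r x a n cs ks :=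
      le_csSup confSet_bddAbove (thr_mem_confSet hr0 (fun c => (hθ c).1) (hgood cs ks))
    have hpos : 0 < CRS.thr r θ cs ks := by
      obtain ⟨k', hk'⟩ := exists_rateDist_eq_one hK ks
      have hne : k' ≠ ks := by
        rintro rfl; rw [rateDist_self] at hk'; exact absurd hk' (by norm_num)
      refine lt_of_le_of_lt ?_ (hbest cs k' fun he => hne (congrArg Prod.snd he))
      exact mul_nonneg (hr0 k').le ((hθ cs).1 k').1
    have h1 := hidx cs ks
    rw [hLc, hLc, hks] at h1
    unfold CRS.leaderIndex at h1
    rw [if_pos rfl] at h1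
    -- the largest index is positive, so the selected rate is a leader
    have hk : k = kb c := by
      by_contra hne
      rw [if_neg hne] at h1
      linarith
    rw [if_pos hk] at h1
    rcases eq_or_ne c cs with rfl | hc
    · exact Or.inr (Or.inr (Or.inr ⟨rfl, hk.trans hks⟩))
    have hmem := (mem_confSet_iff hr0).1 (ucb_mem_confSet hr0 hx hn3 (hpull c k))
    have hrk := hr0 k
    have hle : CRS.thr r θ cs ks ≤ r k := hucb.trans (h1.trans hmem.1.2)
    have hpq : θ c k < CRS.thr r θ cs ks / r k := by
      rw [lt_div_iff₀ hrk, mul_comm]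
      exact hbest c k fun he => hc (congrArg Prod.fst he)
    rcases hl.up hl1 ((hθ c).1 k).1 hpq (div_le_div_of_nonneg_right (hucb.trans h1) hrk.le)
      ((div_le_one hrk).2 hmem.1.2)
      (avg_mem_Icc (hx c k) _).1 hmem.2 with h2 | h2
    · exact Or.inr (Or.inr (Or.inl ⟨hc, hk, hle, _, hpull c k, le_rfl, pulls_le _ _ _ _, h2⟩))
    · refine Or.inr (Or.inl ⟨by rw [hk, rateDist_self]; norm_num, hlog _ (le_trans ?_ h2)⟩)
      gcongr
      rw [hk]
      exact tau_le_kl_best hc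

end Step

/-! ### Regret as a sum of losses -/

theorem CRS.IsOutcomeModel.isBernoulliSeq {C K : ℕ} {Ω : Type*} [MeasurableSpace Ω]
    {P : Measure Ω} {θ : Fin C → Fin K → ℝ} {X : Fin C → Fin K → ℕ → Ω → ℝ}
    (h : CRS.IsOutcomeModel P θ X) (c : Fin C) (k : Fin K) :
    IsBernoulliSeq P (θ c k) (X c k) :=
  ⟨h.measurable c k, h.binary c k, h.mean c k, h.indep c k⟩

theorem sum_selected {C K : ℕ} (a : ℕ → Fin C × Fin K) (F : Fin C → Fin K → ℕ → ℝ) (T : ℕ) :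
    ∑ n ∈ Finset.range T, F (a n).1 (a n).2 (CRS.pulls a n (a n).1 (a n).2) =
      ∑ c, ∑ k, ∑ s ∈ Finset.range (CRS.pulls a T c k), F c k s := by
  simp_rw [← sum_ite_selected]
  rw [← Fintype.sum_prod_type', Finset.sum_comm]
  refine Finset.sum_congr rfl fun n _ => ?_
  rw [Finset.sum_eq_single (a n)]
  · rw [if_pos rfl]
  · intro b _ hb
    rw [if_neg fun h => hb h.symm]
  · simp

/-- The regret is the expected sum of the losses of the successive selections. -/
theorem regret_eq_integral {C K : ℕ} {Ω : Type*} [MeasurableSpace Ω] (P : Measure Ω)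
    [IsProbabilityMeasure P] (r : Fin K → ℝ) (θ : Fin C → Fin K → ℝ) (cs : Fin C) (ks : Fin K)
    {sel : ℕ → Ω → Fin C × Fin K} (hsel : ∀ n, Measurable (sel n)) (T : ℕ) :
    Integrable (fun ω => ∑ n ∈ Finset.range T,
      (CRS.thr r θ cs ks - CRS.thr r θ (sel n ω).1 (sel n ω).2)) P ∧
    CRS.regret P r θ cs ks sel T = ∫ ω, ∑ n ∈ Finset.range T,
      (CRS.thr r θ cs ks - CRS.thr r θ (sel n ω).1 (sel n ω).2) ∂P := by
  have hmeas : ∀ c k, Measurable fun ω => (CRS.pulls (fun n => sel n ω) T c k : ℝ) := fun c k => by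
    unfold CRS.pulls
    simp only [Finset.card_filter, Nat.cast_sum, Nat.cast_ite, Nat.cast_one, Nat.cast_zero]
    exact Finset.measurable_sum _ fun m _ => Measurable.ite
      (hsel m (measurableSet_singleton (c, k))) measurable_const measurable_const
  have hint : ∀ c k, Integrable (fun ω => (CRS.pulls (fun n => sel n ω) T c k : ℝ)) P := fun c k =>
    Integrable.of_bound (hmeas c k).aestronglyMeasurable T (ae_of_all _ fun ω => by
      rw [Real.norm_of_nonneg (Nat.cast_nonneg _)]
      exact Nat.cast_le.2 (pulls_le _ _ _ _))
  have heq : (fun ω => ∑ n ∈ Finset.range T,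
      (CRS.thr r θ cs ks - CRS.thr r θ (sel n ω).1 (sel n ω).2)) =
      fun ω => CRS.thr r θ cs ks * T -
        ∑ c, ∑ k, CRS.thr r θ c k * (CRS.pulls (fun n => sel n ω) T c k : ℝ) := by
    ext ω
    rw [Finset.sum_sub_distrib,
      sum_selected (fun n => sel n ω) (fun c k _ => CRS.thr r θ c k) T]
    simp [mul_comm]
  have hsum : Integrable (fun ω =>
      ∑ c, ∑ k, CRS.thr r θ c k * (CRS.pulls (fun n => sel n ω) T c k : ℝ)) P :=
    integrable_finsetSum _ fun c _ => integrable_finsetSum _ fun k _ => (hint c k).const_mul _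
  rw [heq]
  refine ⟨(integrable_const _).sub hsum, ?_⟩
  rw [integral_sub (integrable_const _) hsum, integral_finsetSum _ fun c _ =>
    integrable_finsetSum _ fun k _ => (hint c k).const_mul _]
  simp_rw [integral_finsetSum _ fun k _ => (hint _ k).const_mul _, integral_const_mul]
  simp [CRS.regret]

theorem crsConst_toReal {C K : ℕ} {r : Fin K → ℝ} {θ : Fin C → Fin K → ℝ} {cs : Fin C}
    {ks : Fin K} {kb : Fin C → Fin K} (hτ : ∀ c, 0 < CRS.tau r θ cs ks c (kb c))
    (hcost : ∀ c k, 0 ≤ CRS.thr r θ cs ks - CRS.thr r θ c k) :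
    (CRS.crsConst r θ cs ks kb).toReal = ∑ c, (CRS.tau r θ cs ks c (kb c))⁻¹.toReal *
      ∑ k ∈ Finset.univ.filter (fun k => CRS.rateDist k (kb c) ≤ 1),
        (CRS.thr r θ cs ks - CRS.thr r θ c k) := by
  rw [CRS.crsConst, ENNReal.toReal_sum fun c _ => ENNReal.mul_ne_top
    (ENNReal.inv_ne_top.2 (hτ c).ne') (ENNReal.sum_ne_top.2 fun _ _ => ENNReal.ofReal_ne_top)]
  refine Finset.sum_congr rfl fun c _ => ?_
  rw [ENNReal.toReal_mul, ENNReal.toReal_sum fun _ _ => ENNReal.ofReal_ne_top]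
  exact congrArg _ (Finset.sum_congr rfl fun k _ => ENNReal.toReal_ofReal (hcost c k))

/-- On each channel the loss of the best rate is among the terms of `crsConst`. -/
theorem mul_le_crsConst {C K : ℕ} {r : Fin K → ℝ} {θ : Fin C → Fin K → ℝ} {cs : Fin C}
    {ks : Fin K} {kb : Fin C → Fin K} (hτ : ∀ c, 0 < CRS.tau r θ cs ks c (kb c))
    (hcost : ∀ c k, 0 ≤ CRS.thr r θ cs ks - CRS.thr r θ c k) (c : Fin C) :
    (CRS.thr r θ cs ks - CRS.thr r θ c (kb c)) * (CRS.tau r θ cs ks c (kb c))⁻¹.toReal ≤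
      (CRS.crsConst r θ cs ks kb).toReal := by
  rw [crsConst_toReal hτ hcost, mul_comm]
  refine le_trans (mul_le_mul_of_nonneg_left ?_ ENNReal.toReal_nonneg)
    (Finset.single_le_sum (f := fun c => (CRS.tau r θ cs ks c (kb c))⁻¹.toReal *
      ∑ k ∈ Finset.univ.filter (fun k => CRS.rateDist k (kb c) ≤ 1),
        (CRS.thr r θ cs ks - CRS.thr r θ c k)) (fun c _ => mul_nonneg ENNReal.toReal_nonneg
          (Finset.sum_nonneg fun k _ => hcost c k)) (Finset.mem_univ c))
  exact Finset.single_le_sum (f := fun k => CRS.thr r θ cs ks - CRS.thr r θ c k)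
    (fun k _ => hcost c k) (Finset.mem_filter.2 ⟨Finset.mem_univ _, by simp [rateDist_self]⟩)

/-- The Bernstein exponent `b` of a deviation from `p` by `l (q - p)` compares with the divergence
`kl p q`: up to constants, `(q - p) / b ≤ 1 + (q - p) / kl p q`. When `1 - q` is of the order of
`1 - p` this is the bound of the divergence by the chi-square distance; otherwise `q - p` is
already of the order of `1 - p`. -/
theorem div_bernstein_exponent_le {p q l : ℝ} {τ : ℝ≥0∞} (hp : 0 ≤ p) (hpq : p < q) (hq : q ≤ 1)
    (hl0 : 0 < l) (hl1 : l < 1) (hτ : 0 < τ) (hτkl : τ ≤ CRS.kl p q) :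
    (q - p) * (1 / ((l * (q - p)) ^ 2 / (4 * (p * (1 - p) + l * (q - p))))) ≤
      4 / l ^ 2 * (3 + 2 * (q - p) * τ⁻¹.toReal) := by
  set h := q - p with hh
  have hh0 : 0 < h := by linarith
  have hv0 : 0 ≤ p * (1 - p) := mul_nonneg hp (by linarith)
  set v := p * (1 - p) with hv
  have hτ0 : 0 ≤ τ⁻¹.toReal := ENNReal.toReal_nonneg
  have hkey : v / h ≤ 2 + 2 * h * τ⁻¹.toReal := by
    rcases le_or_gt h ((1 - p) / 2) with hsmall | hbig
    · have hq0 : 0 < q := by linarith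
      have hq1 : q < 1 := by linarith
      have hd := bernDiv_pos ⟨hp, by linarith⟩ hq0 hq1 hpq.ne
      rw [kl_eq_ofReal_bernDiv hq0 hq1] at hτkl
      have h1 : (bernDiv p q)⁻¹ ≤ τ⁻¹.toReal := by
        have h2 := ENNReal.toReal_mono (ENNReal.inv_ne_top.2 hτ.ne') (ENNReal.inv_le_inv.2 hτkl)
        rwa [← ENNReal.ofReal_inv_of_pos hd, ENNReal.toReal_ofReal (inv_nonneg.2 hd.le)] at h2
      have h3 : bernDiv p q * (q * (1 - q)) ≤ h ^ 2 := by
        rw [← le_div_iff₀ (mul_pos hq0 (by linarith))]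
        exact bernDiv_le_sq_div ⟨hp, by linarith⟩ hq0 hq1
      have h4 : v ≤ 2 * (q * (1 - q)) := by
        rw [hv]
        have : p * ((1 - p) / 2) ≤ q * (1 - q) :=
          mul_le_mul hpq.le (by linarith) (by linarith) hq0.le
        linarith
      have h5 : v / h ≤ 2 * h * (bernDiv p q)⁻¹ := by
        rw [div_le_iff₀ hh0, ← div_eq_mul_inv, div_mul_eq_mul_div, le_div_iff₀ hd]
        nlinarith [mul_le_mul_of_nonneg_left h4 hd.le]
      have h6 : 2 * h * (bernDiv p q)⁻¹ ≤ 2 * h * τ⁻¹.toReal := by gcongr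
      linarith
    · have h1 : v / h ≤ 2 := by
        rw [div_le_iff₀ hh0, hv]; nlinarith
      have : 0 ≤ 2 * h * τ⁻¹.toReal := by positivity
      linarith
  have hd : v + l * h ≠ 0 := by have := mul_pos hl0 hh0; linarith
  calc h * (1 / ((l * h) ^ 2 / (4 * (v + l * h)))) = 4 / l ^ 2 * (v / h + l) := by
        field_simp
    _ ≤ _ := mul_le_mul_of_nonneg_left (by linarith) (by positivity)

theorem sum_ite_natCast_le_le (N : ℕ) {b : ℝ} (hb : 0 ≤ b) :
    ∑ s ∈ Finset.range N, (if (s : ℝ) ≤ b then (1 : ℝ) else 0) ≤ b + 1 := by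
  rw [← Finset.sum_filter, Finset.sum_const, nsmul_eq_mul, mul_one]
  have hsub : (Finset.range N).filter (fun s : ℕ => (s : ℝ) ≤ b) ⊆ Finset.range (⌊b⌋₊ + 1) := by
    intro s hs
    exact Finset.mem_range.2 (Nat.lt_succ_of_le (Nat.le_floor (Finset.mem_filter.1 hs).2))
  have h1 := Finset.card_le_card hsub
  rw [Finset.card_range] at h1
  calc _ ≤ ((⌊b⌋₊ + 1 : ℕ) : ℝ) := by exact_mod_cast h1
    _ ≤ b + 1 := by push_cast; linarith [Nat.floor_le hb]

/-- The indicator of a measurable hull of `S`, so that no measurability of `S` is needed. -/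
noncomputable def hullInd {Ω : Type*} [MeasurableSpace Ω] (P : Measure Ω) (S : Set Ω) (ω : Ω) : ℝ :=
  (toMeasurable P S).indicator (fun _ => (1 : ℝ)) ω

section HullInd

variable {Ω : Type*} [MeasurableSpace Ω] (P : Measure Ω) (S : Set Ω)

theorem hullInd_nonneg (ω : Ω) : 0 ≤ hullInd P S ω :=
  Set.indicator_nonneg (fun _ _ => zero_le_one) ω

theorem integrable_hullInd [IsFiniteMeasure P] : Integrable (hullInd P S) P :=
  (integrable_const _).indicator (measurableSet_toMeasurable P S)

theorem integral_hullInd_le {b : ℝ} (hb : 0 ≤ b) (h : P S ≤ ENNReal.ofReal b) :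
    ∫ ω, hullInd P S ω ∂P ≤ b := by
  unfold hullInd
  rw [integral_indicator_const _ (measurableSet_toMeasurable P S), measureReal_def,
    measure_toMeasurable, smul_eq_mul, mul_one]
  exact ENNReal.toReal_le_of_le_ofReal hb h

end HullInd

theorem hullInd_of_mem {Ω : Type*} [MeasurableSpace Ω] (P : Measure Ω) {S : Set Ω} {ω : Ω}
    (h : ω ∈ S) : hullInd P S ω = 1 :=
  Set.indicator_of_mem (subset_toMeasurable P S h) _

/-! ### The regret bound -/

/-- The regret bound before the terms are compared: the initial selections, the selections made
while some confidence interval is wrong, and, for each pair, the sum over its number of selections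
of the probabilities of the cases of `selection_cases`. Only the leading term involves `explor T`;
every other dependence on the gap between the best channel and the others is through the constant
`crsConst` itself. -/
theorem regret_le {C K : ℕ} {r : Fin K → ℝ} {θ : Fin C → Fin K → ℝ} {ε l R : ℝ} (hε : 0 < ε)
    (hl : IsKLFraction ε l) (hl0 : 0 < l) (hl1 : l < 1) (hK : 2 ≤ K) (hr0 : ∀ k, 0 < r k)
    (hR : ∀ k, r k ≤ R) (hθ : ∀ c, θ c ∈ CRS.unimodalSet r) {cs : Fin C} {ks : Fin K}
    (hbest : CRS.IsBestPair r θ cs ks) {kb : Fin C → Fin K}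
    (hkb : ∀ c, CRS.IsBestRate r θ c (kb c)) {Ω : Type*} [MeasurableSpace Ω] {P : Measure Ω}
    [IsProbabilityMeasure P] {X : Fin C → Fin K → ℕ → Ω → ℝ} (hX : CRS.IsOutcomeModel P θ X)
    {sel : ℕ → Ω → Fin C × Fin K} (hsel : ∀ n, Measurable (sel n))
    (hcrs : ∀ ω, CRS.IsCRST r (fun c k i => X c k i ω) (fun n => sel n ω)) {T : ℕ} (hT : 3 ≤ T) :
    CRS.regret P r θ cs ks sel T ≤
      R * (max (C * K) 3 : ℕ) +
      R * (C * K * (10 * Real.exp 1) * (Real.log (Real.log T) - Real.log (Real.log 2))) +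
      ((1 + ε) * explor T * (CRS.crsConst r θ cs ks kb).toReal +
      C * K * (R * (K * (2 + 40 * R ^ 2 / l ^ 2 * (CRS.minGap r θ)⁻¹ ^ 2)) + R +
        (R + 4 / l ^ 2 * (3 * R + 2 * (CRS.crsConst r θ cs ks kb).toReal)))) := by
  have hΔ := minGap_pos hK hθ hkb cs
  have hR0 : 0 < R := (hr0 ks).trans_le (hR ks)
  have hθI : ∀ c k, θ c k ∈ Set.Icc (0 : ℝ) 1 := fun c => (hθ c).1
  have hτ := tau_pos hK hr0 hθ hbest hkb
  have hthr0 : ∀ c k, 0 ≤ CRS.thr r θ c k := fun c k => mul_nonneg (hr0 k).le (hθI c k).1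
  have hcost0 : ∀ c k, 0 ≤ CRS.thr r θ cs ks - CRS.thr r θ c k := fun c k => by
    by_cases h : (c, k) = (cs, ks)
    · simp only [Prod.mk.injEq] at h; rw [h.1, h.2, sub_self]
    · exact (sub_pos.2 (hbest c k h)).le
  have hcostR : ∀ c k, CRS.thr r θ cs ks - CRS.thr r θ c k ≤ R := fun c k => by
    have : CRS.thr r θ cs ks ≤ r ks := mul_le_of_le_one_right (hr0 ks).le (hθI cs ks).2
    linarith [hR ks, hthr0 c k]
  have hseq := hX.isBernoulliSeq
  set μs := CRS.thr r θ cs ks with hμs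
  set crs := (CRS.crsConst r θ cs ks kb).toReal with hcrsdef
  have hcrs0 : 0 ≤ crs := ENNReal.toReal_nonneg
  have hfT := explor_pos hT
  set d := l * (CRS.minGap r θ / 2) with hd
  have hd0 : 0 < d := by positivity
  set s₀ : Fin C → ℝ := fun c =>
    (1 + ε) * explor T * (CRS.tau r θ cs ks c (kb c))⁻¹.toReal with hs₀
  have hs₀0 : ∀ c, 0 ≤ s₀ c := fun c =>
    mul_nonneg (mul_nonneg (by linarith) hfT.le) ENNReal.toReal_nonneg
  -- the three families of exceptional events
  set E : Fin C → Fin K → ℕ → Set Ω := fun c k n => {ω | ∃ s : ℕ, 1 ≤ s ∧ s ≤ n ∧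
    ENNReal.ofReal (explor n) < s * CRS.kl (avg (fun i => X c k i ω) s) (θ c k)} with hE
  set H : Fin C → Fin K → ℕ → Set Ω := fun c j m => {ω | ∃ s : ℕ, 1 ≤ s ∧ m ≤ s ∧ s ≤ T ∧
    d / r j ≤ |avg (fun i => X c j i ω) s - θ c j|} with hH
  set G : Fin C → Fin K → ℕ → Set Ω := fun c k m => {ω | ∃ s : ℕ, 1 ≤ s ∧ m ≤ s ∧ s ≤ T ∧
    θ c k + l * (μs / r k - θ c k) ≤ avg (fun i => X c k i ω) s} with hG
  set F : Fin C → Fin K → ℕ → Ω → ℝ := fun c k s ω => R * ∑ j, hullInd P (H c j s) ω +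
    (if CRS.rateDist k (kb c) ≤ 1 then
      (μs - CRS.thr r θ c k) * (if (s : ℝ) ≤ s₀ c then 1 else 0) else 0) +
    (if c ≠ cs ∧ k = kb c ∧ μs ≤ r k then
      (μs - CRS.thr r θ c k) * hullInd P (G c k s) ω else 0) with hF
  have hHsum0 : ∀ c s ω, 0 ≤ R * ∑ j, hullInd P (H c j s) ω := fun c s ω =>
    mul_nonneg hR0.le (Finset.sum_nonneg fun j _ => hullInd_nonneg _ _ _)
  have hA0 : ∀ c k (s : ℕ), 0 ≤ (if CRS.rateDist k (kb c) ≤ 1 then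
      (μs - CRS.thr r θ c k) * (if (s : ℝ) ≤ s₀ c then 1 else 0) else 0) := fun c k s => by
    split_ifs <;> simp [hcost0 c k]
  have hG0 : ∀ c k s ω, 0 ≤ (if c ≠ cs ∧ k = kb c ∧ μs ≤ r k then
      (μs - CRS.thr r θ c k) * hullInd P (G c k s) ω else 0) := fun c k s ω => by
    split_ifs
    · exact mul_nonneg (hcost0 c k) (hullInd_nonneg _ _ _)
    · exact le_rfl
  have hF0 : ∀ c k s ω, 0 ≤ F c k s ω := fun c k s ω =>
    add_nonneg (add_nonneg (hHsum0 c s ω) (hA0 c k s)) (hG0 c k s ω)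
  have hE0 : ∀ n ω, 0 ≤ ∑ c, ∑ k, hullInd P (E c k n) ω := fun n ω =>
    Finset.sum_nonneg fun c _ => Finset.sum_nonneg fun k _ => hullInd_nonneg _ _ _
  -- the loss of one selection
  have hstep : ∀ ω, ∀ n ∈ Finset.range T, μs - CRS.thr r θ (sel n ω).1 (sel n ω).2 ≤
      (if n < max (C * K) 3 then R else 0) +
      (if n ∈ Finset.Ico 3 (T + 1) then R * ∑ c, ∑ k, hullInd P (E c k n) ω else 0) +
      F (sel n ω).1 (sel n ω).2
        (CRS.pulls (fun n => sel n ω) n (sel n ω).1 (sel n ω).2) ω := by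
    intro ω n hnT
    have hnT := Finset.mem_range.1 hnT
    have hb1 : 0 ≤ (if n < max (C * K) 3 then R else 0) := by split_ifs <;> linarith
    have hb2 : 0 ≤ (if n ∈ Finset.Ico 3 (T + 1) then
        R * ∑ c, ∑ k, hullInd P (E c k n) ω else 0) := by
      split_ifs
      · exact mul_nonneg hR0.le (hE0 n ω)
      · exact le_rfl
    obtain ⟨c, k, hck⟩ : ∃ c k, sel n ω = (c, k) := ⟨_, _, rfl⟩
    have hb3 := hF0 (sel n ω).1 (sel n ω).2
      (CRS.pulls (fun n => sel n ω) n (sel n ω).1 (sel n ω).2) ω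
    by_cases hn0 : n < max (C * K) 3
    · rw [if_pos hn0]
      linarith [hcostR (sel n ω).1 (sel n ω).2]
    rw [not_lt, max_le_iff] at hn0
    obtain ⟨hnCK, hn3⟩ := hn0
    by_cases hEn : ∃ c k, ω ∈ E c k n
    · obtain ⟨c', k', hmem⟩ := hEn
      have h1 : 1 ≤ ∑ c, ∑ k, hullInd P (E c k n) ω := by
        rw [← hullInd_of_mem P hmem]
        refine le_trans ?_ (Finset.single_le_sum (f := fun c => ∑ k, hullInd P (E c k n) ω)
          (fun c _ => Finset.sum_nonneg fun k _ => hullInd_nonneg _ _ _) (Finset.mem_univ c'))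
        exact Finset.single_le_sum (f := fun k => hullInd P (E c' k n) ω)
          (fun k _ => hullInd_nonneg _ _ _) (Finset.mem_univ k')
      rw [if_pos (Finset.mem_Ico.2 ⟨hn3, by omega⟩)]
      have h2 := le_mul_of_one_le_right hR0.le h1
      linarith [hcostR (sel n ω).1 (sel n ω).2]
    suffices hFle : μs - CRS.thr r θ (sel n ω).1 (sel n ω).2 ≤ F (sel n ω).1 (sel n ω).2
        (CRS.pulls (fun n => sel n ω) n (sel n ω).1 (sel n ω).2) ω by linarith
    push Not at hEn
    have hgood : ∀ c k, (CRS.pulls (fun n => sel n ω) n c k : ℝ≥0∞) *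
        CRS.kl (avg (fun i => X c k i ω) (CRS.pulls (fun n => sel n ω) n c k)) (θ c k) ≤
          ENNReal.ofReal (explor n) := fun c k => by
      by_contra! hlt
      exact hEn c k ⟨_, one_le_pulls (hcrs ω) hnCK c k, pulls_le _ _ _ _, hlt⟩
    have hcases := selection_cases hε hl hl0 hl1 hK hr0 hθ hbest hkb
      (fun c k i => hX.binary c k i ω) (hcrs ω) hn3 hnCK hgood hck
    rw [hck]
    simp only
    rcases hcases with ⟨j, s, h1, h2, h3, h4⟩ | ⟨h1, h2⟩ | ⟨h1, h2, h3, s, h4, h5, h6, h7⟩ | ⟨h1, h2⟩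
    · have hmem : ω ∈ H c j (CRS.pulls (fun n => sel n ω) n c k) := by
        refine ⟨s, h1, h2, by omega, ?_⟩
        rw [← mul_sub, abs_mul, abs_of_pos (hr0 j)] at h4
        rw [div_le_iff₀ (hr0 j), mul_comm]
        exact h4
      have h5 : 1 ≤ ∑ j, hullInd P (H c j (CRS.pulls (fun n => sel n ω) n c k)) ω := by
        rw [← hullInd_of_mem P hmem]
        exact Finset.single_le_sum
          (f := fun j => hullInd P (H c j (CRS.pulls (fun n => sel n ω) n c k)) ω)
          (fun k _ => hullInd_nonneg _ _ _) (Finset.mem_univ j)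
      have h6 := le_mul_of_one_le_right hR0.le h5
      simp only [hF]
      linarith [hcostR c k, hA0 c k (CRS.pulls (fun n => sel n ω) n c k),
        hG0 c k (CRS.pulls (fun n => sel n ω) n c k) ω]
    · have hle : (CRS.pulls (fun n => sel n ω) n c k : ℝ) ≤ s₀ c := by
        have h3 := ENNReal.toReal_mono (ENNReal.mul_ne_top ENNReal.ofReal_ne_top
          (ENNReal.inv_ne_top.2 (hτ c).ne')) h2
        rw [ENNReal.toReal_mul, ENNReal.toReal_natCast,
          ENNReal.toReal_ofReal (mul_nonneg (by linarith) (explor_pos hn3).le)] at h3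
        refine h3.trans (mul_le_mul_of_nonneg_right ?_ ENNReal.toReal_nonneg)
        exact mul_le_mul_of_nonneg_left (explor_mono hn3 hnT.le) (by linarith)
      have h3 := hHsum0 c (CRS.pulls (fun n => sel n ω) n c k) ω
      have h4 := hG0 c k (CRS.pulls (fun n => sel n ω) n c k) ω
      simp only [hF]
      rw [if_pos h1, if_pos hle, mul_one]
      linarith
    · have hmem : ω ∈ G c k (CRS.pulls (fun n => sel n ω) n c k) := ⟨s, h4, h5, by omega, h7⟩
      have h8 := hHsum0 c (CRS.pulls (fun n => sel n ω) n c k) ω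
      have h9 := hA0 c k (CRS.pulls (fun n => sel n ω) n c k)
      simp only [hF]
      rw [if_pos (show c ≠ cs ∧ k = kb c ∧ μs ≤ r k from ⟨h1, h2, h3⟩), hullInd_of_mem P hmem,
        mul_one]
      linarith
    · have := hF0 c k (CRS.pulls (fun n => sel n ω) n c k) ω
      rw [h1, h2] at this ⊢
      rw [← hμs, sub_self]
      exact this
  -- summation over the selections
  have hpath : ∀ ω, ∑ n ∈ Finset.range T, (μs - CRS.thr r θ (sel n ω).1 (sel n ω).2) ≤
      R * (max (C * K) 3 : ℕ) +
      R * ∑ n ∈ Finset.Ico 3 (T + 1), ∑ c, ∑ k, hullInd P (E c k n) ω +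
      ∑ c, ∑ k, ∑ s ∈ Finset.range T, F c k s ω := by
    intro ω
    refine (Finset.sum_le_sum (hstep ω)).trans ?_
    rw [Finset.sum_add_distrib, Finset.sum_add_distrib]
    refine add_le_add (add_le_add ?_ ?_) ?_
    · rw [← Finset.sum_filter, Finset.sum_const, nsmul_eq_mul, mul_comm]
      refine mul_le_mul_of_nonneg_left ?_ hR0.le
      have hsub : (Finset.range T).filter (fun n => n < max (C * K) 3) ⊆
          Finset.range (max (C * K) 3) := fun n hn =>
        Finset.mem_range.2 (Finset.mem_filter.1 hn).2
      have := Finset.card_le_card hsub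
      rw [Finset.card_range] at this
      exact Nat.cast_le.2 this
    · rw [← Finset.sum_filter, Finset.mul_sum]
      refine Finset.sum_le_sum_of_subset_of_nonneg
        (fun n hn => (Finset.mem_filter.1 hn).2) fun n _ _ => mul_nonneg hR0.le (hE0 n ω)
    · rw [sum_selected (fun n => sel n ω) (fun c k s => F c k s ω) T]
      refine Finset.sum_le_sum fun c _ => Finset.sum_le_sum fun k _ =>
        Finset.sum_le_sum_of_subset_of_nonneg ?_ fun s _ _ => hF0 c k s ω
      exact Finset.range_subset_range.2 (pulls_le _ _ _ _)
  -- expectations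
  have hEint : ∀ c k, ∀ n ∈ Finset.Ico 3 (T + 1), ∫ ω, hullInd P (E c k n) ω ∂P ≤
      10 * Real.exp 1 * (1 / (n * Real.log n)) := fun c k n hn => by
    have hn3 := (Finset.mem_Ico.1 hn).1
    have := one_lt_log_natCast hn3
    rw [mul_one_div]
    exact integral_hullInd_le P _ (by positivity) ((hseq c k).measure_exists_lt_mul_kl_le hn3)
  have hHint : ∀ c j (s : ℕ), ∫ ω, hullInd P (H c j s) ω ∂P ≤
      2 * Real.exp (-(s * ((d / r j) ^ 2 / 5))) := fun c j s =>
    integral_hullInd_le P _ (by positivity)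
      ((hseq c j).measure_abs_avg_sub_ge_le (div_pos hd0 (hr0 j)) s T)
  have hHsum : ∀ c j, ∑ s ∈ Finset.range T, ∫ ω, hullInd P (H c j s) ω ∂P ≤
      2 + 40 * R ^ 2 / l ^ 2 * (CRS.minGap r θ)⁻¹ ^ 2 := fun c j => by
    refine (Finset.sum_le_sum fun s _ => hHint c j s).trans ?_
    rw [← Finset.mul_sum]
    have h1 := sum_exp_neg_mul_le (b := (d / r j) ^ 2 / 5)
      (by have := div_pos hd0 (hr0 j); positivity) T
    have h2 : 1 / ((d / r j) ^ 2 / 5) = 20 * r j ^ 2 / l ^ 2 * (CRS.minGap r θ)⁻¹ ^ 2 := by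
      have := (hr0 j).ne'
      rw [hd]; field_simp; ring
    have h3 : 20 * r j ^ 2 / l ^ 2 * (CRS.minGap r θ)⁻¹ ^ 2 ≤
        20 * R ^ 2 / l ^ 2 * (CRS.minGap r θ)⁻¹ ^ 2 := by
      have := hr0 j
      have := hR j
      gcongr
    have h4 : 40 * R ^ 2 / l ^ 2 * (CRS.minGap r θ)⁻¹ ^ 2 =
        2 * (20 * R ^ 2 / l ^ 2 * (CRS.minGap r θ)⁻¹ ^ 2) := by ring
    linarith
  have hGsum : ∀ c k, c ≠ cs ∧ k = kb c ∧ μs ≤ r k →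
      (μs - CRS.thr r θ c k) * ∑ s ∈ Finset.range T, ∫ ω, hullInd P (G c k s) ω ∂P ≤
      R + 4 / l ^ 2 * (3 * R + 2 * crs) := by
    rintro c k ⟨hc, hk, hle⟩
    have hrk := hr0 k
    have hlt := hbest c k fun he => hc (congrArg Prod.fst he)
    have hpq : θ c k < μs / r k := by
      rw [lt_div_iff₀ hrk, mul_comm]; exact hlt
    have hq1 : μs / r k ≤ 1 := (div_le_one hrk).2 hle
    have hz : 0 < l * (μs / r k - θ c k) := mul_pos hl0 (sub_pos.2 hpq)
    set b := (l * (μs / r k - θ c k)) ^ 2 /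
      (4 * (θ c k * (1 - θ c k) + l * (μs / r k - θ c k))) with hb
    have hv : 0 ≤ θ c k * (1 - θ c k) := mul_nonneg (hθI c k).1 (by linarith [(hθI c k).2])
    have hb0 : 0 < b := by positivity
    have h1 : ∑ s ∈ Finset.range T, ∫ ω, hullInd P (G c k s) ω ∂P ≤ 1 + 1 / b :=
      (Finset.sum_le_sum fun s _ => integral_hullInd_le P _ (Real.exp_pos _).le
        ((hseq c k).bernstein hz s T)).trans (sum_exp_neg_mul_le hb0 T)
    have h2 := div_bernstein_exponent_le (hθI c k).1 hpq hq1 hl0 hl1 (hτ c)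
      (by rw [hk]; exact tau_le_kl_best hc)
    rw [← hb] at h2
    have h3 : μs - CRS.thr r θ c k = r k * (μs / r k - θ c k) := by
      rw [CRS.thr]; field_simp
    have h4 := mul_le_crsConst hτ hcost0 c
    rw [← hk, ← hcrsdef, ← hμs, h3] at h4
    calc (μs - CRS.thr r θ c k) * ∑ s ∈ Finset.range T, ∫ ω, hullInd P (G c k s) ω ∂P
        ≤ (μs - CRS.thr r θ c k) * (1 + 1 / b) := mul_le_mul_of_nonneg_left h1 (hcost0 c k)
      _ = (μs - CRS.thr r θ c k) + r k * ((μs / r k - θ c k) * (1 / b)) := by rw [h3]; ring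
      _ ≤ R + r k * (4 / l ^ 2 * (3 + 2 * (μs / r k - θ c k) *
            (CRS.tau r θ cs ks c (kb c))⁻¹.toReal)) :=
          add_le_add (hcostR c k) (mul_le_mul_of_nonneg_left h2 hrk.le)
      _ = R + 4 / l ^ 2 * (3 * r k + 2 * (r k * (μs / r k - θ c k) *
            (CRS.tau r θ cs ks c (kb c))⁻¹.toReal)) := by ring
      _ ≤ _ := by
          have := hR k
          rw [hk] at h4 ⊢
          gcongr
          · exact hR _
  have hHi : ∀ c s, Integrable (fun ω => R * ∑ j, hullInd P (H c j s) ω) P := fun c s =>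
    (integrable_finsetSum _ fun j _ => integrable_hullInd P _).const_mul R
  have hGi : ∀ c k s, Integrable (fun ω => if c ≠ cs ∧ k = kb c ∧ μs ≤ r k then
      (μs - CRS.thr r θ c k) * hullInd P (G c k s) ω else 0) P := fun c k s => by
    split_ifs
    · exact (integrable_hullInd P _).const_mul _
    · exact integrable_const _
  have hFi : ∀ c k s, Integrable (F c k s) P := fun c k s =>
    ((hHi c s).add (integrable_const _)).add (hGi c k s)
  have hFint : ∀ c k, ∑ s ∈ Finset.range T, ∫ ω, F c k s ω ∂P ≤
      (if CRS.rateDist k (kb c) ≤ 1 then (μs - CRS.thr r θ c k) * s₀ c else 0) +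
      (R * (K * (2 + 40 * R ^ 2 / l ^ 2 * (CRS.minGap r θ)⁻¹ ^ 2)) + R +
        (R + 4 / l ^ 2 * (3 * R + 2 * crs))) := fun c k => by
    have h1 : ∀ s, ∫ ω, F c k s ω ∂P = R * ∑ j, ∫ ω, hullInd P (H c j s) ω ∂P +
        (if CRS.rateDist k (kb c) ≤ 1 then
          (μs - CRS.thr r θ c k) * (if (s : ℝ) ≤ s₀ c then 1 else 0) else 0) +
        (if c ≠ cs ∧ k = kb c ∧ μs ≤ r k then
          (μs - CRS.thr r θ c k) * ∫ ω, hullInd P (G c k s) ω ∂P else 0) := fun s => by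
      have hHAi : Integrable (fun ω => R * ∑ j, hullInd P (H c j s) ω +
          (if CRS.rateDist k (kb c) ≤ 1 then
            (μs - CRS.thr r θ c k) * (if (s : ℝ) ≤ s₀ c then 1 else 0) else 0)) P :=
        (hHi c s).add (integrable_const _)
      simp only [hF]
      rw [integral_add hHAi (hGi c k s),
        integral_add (hHi c s) (integrable_const _), integral_const_mul,
        integral_finsetSum _ fun j _ => integrable_hullInd P _]
      congr 1
      · simp
      · split_ifs
        · rw [integral_const_mul]
        · simp
    simp_rw [h1]
    rw [Finset.sum_add_distrib, Finset.sum_add_distrib, ← Finset.mul_sum, Finset.sum_comm]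
    have h2 : R * ∑ j, ∑ s ∈ Finset.range T, ∫ ω, hullInd P (H c j s) ω ∂P ≤
        R * (K * (2 + 40 * R ^ 2 / l ^ 2 * (CRS.minGap r θ)⁻¹ ^ 2)) := by
      refine mul_le_mul_of_nonneg_left ((Finset.sum_le_sum fun j _ => hHsum c j).trans ?_) hR0.le
      rw [Finset.sum_const, Finset.card_univ, Fintype.card_fin, nsmul_eq_mul]
    have h3 : ∑ s ∈ Finset.range T, (if CRS.rateDist k (kb c) ≤ 1 then
          (μs - CRS.thr r θ c k) * (if (s : ℝ) ≤ s₀ c then 1 else 0) else 0) ≤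
        (if CRS.rateDist k (kb c) ≤ 1 then (μs - CRS.thr r θ c k) * s₀ c else 0) + R := by
      by_cases hnear : CRS.rateDist k (kb c) ≤ 1
      · simp only [if_pos hnear]
        rw [← Finset.mul_sum]
        have := mul_le_mul_of_nonneg_left (sum_ite_natCast_le_le T (hs₀0 c)) (hcost0 c k)
        linarith [hcostR c k]
      · simp [hnear, hR0.le]
    have h4 : ∑ s ∈ Finset.range T, (if c ≠ cs ∧ k = kb c ∧ μs ≤ r k then
          (μs - CRS.thr r θ c k) * ∫ ω, hullInd P (G c k s) ω ∂P else 0) ≤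
        R + 4 / l ^ 2 * (3 * R + 2 * crs) := by
      by_cases hc : c ≠ cs ∧ k = kb c ∧ μs ≤ r k
      · simp only [if_pos hc]
        rw [← Finset.mul_sum]
        exact hGsum c k hc
      · simp only [if_neg hc, Finset.sum_const_zero]
        positivity
    linarith
  have hmain : ∑ c, ∑ k, (if CRS.rateDist k (kb c) ≤ 1 then
      (μs - CRS.thr r θ c k) * s₀ c else 0) = (1 + ε) * explor T * crs := by
    rw [hcrsdef, crsConst_toReal hτ hcost0, Finset.mul_sum]
    refine Finset.sum_congr rfl fun c _ => ?_
    rw [← Finset.sum_filter, ← Finset.sum_mul, hs₀]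
    ring
  obtain ⟨hci, hreg⟩ := regret_eq_integral P r θ cs ks hsel T
  have hEi : Integrable (fun ω => R * ∑ n ∈ Finset.Ico 3 (T + 1),
      ∑ c, ∑ k, hullInd P (E c k n) ω) P :=
    (integrable_finsetSum _ fun n _ => integrable_finsetSum _ fun c _ =>
      integrable_finsetSum _ fun k _ => integrable_hullInd P _).const_mul R
  have hFsi : Integrable (fun ω => ∑ c, ∑ k, ∑ s ∈ Finset.range T, F c k s ω) P :=
    integrable_finsetSum _ fun c _ => integrable_finsetSum _ fun k _ =>
      integrable_finsetSum _ fun s _ => hFi c k s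
  have hREi : Integrable (fun ω => R * (max (C * K) 3 : ℕ) + R * ∑ n ∈ Finset.Ico 3 (T + 1),
      ∑ c, ∑ k, hullInd P (E c k n) ω) P := (integrable_const _).add hEi
  rw [hreg]
  refine (integral_mono hci (hREi.add hFsi) hpath).trans ?_
  simp only [Pi.add_apply]
  rw [integral_add hREi hFsi, integral_add (integrable_const _) hEi, integral_const]
  rw [probReal_univ, one_smul, integral_const_mul]
  refine add_le_add (add_le_add le_rfl (mul_le_mul_of_nonneg_left ?_ hR0.le)) ?_
  · rw [integral_finsetSum _ fun n _ => integrable_finsetSum _ fun c _ =>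
      integrable_finsetSum _ fun k _ => integrable_hullInd P _]
    calc _ ≤ ∑ n ∈ Finset.Ico 3 (T + 1), C * K * (10 * Real.exp 1) *
          (1 / ((n : ℝ) * Real.log n)) := by
          refine Finset.sum_le_sum fun n hn => ?_
          rw [integral_finsetSum _ fun c _ =>
            integrable_finsetSum _ fun k _ => integrable_hullInd P _]
          simp_rw [integral_finsetSum _ fun k _ => integrable_hullInd P (E _ k n)]
          refine (Finset.sum_le_sum fun c _ => Finset.sum_le_sum fun k _ => hEint c k n hn).trans ?_
          refine le_of_eq ?_
          simp only [Finset.sum_const, Finset.card_univ, Fintype.card_fin, nsmul_eq_mul]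
          ring
      _ ≤ _ := by
          rw [← Finset.mul_sum]
          exact mul_le_mul_of_nonneg_left (sum_one_div_mul_log_le T (by omega)) (by positivity)
  · rw [integral_finsetSum _ fun c _ => integrable_finsetSum _ fun k _ =>
      integrable_finsetSum _ fun s _ => hFi c k s]
    simp_rw [integral_finsetSum _ fun k _ => integrable_finsetSum _ fun s _ => hFi _ k s,
      integral_finsetSum _ fun s _ => hFi _ _ s]
    refine (Finset.sum_le_sum fun c _ => Finset.sum_le_sum fun k _ => hFint c k).trans ?_
    simp_rw [Finset.sum_add_distrib]
    rw [hmain]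
    refine le_of_eq ?_
    simp only [Finset.sum_const, Finset.card_univ, Fintype.card_fin, nsmul_eq_mul]
    ring

theorem log_log_three_pos : 0 < Real.log (Real.log 3) :=
  Real.log_pos (by exact_mod_cast one_lt_log_natCast (le_refl 3))

theorem log_log_three_le {T : ℕ} (hT : 3 ≤ T) :
    Real.log (Real.log 3) ≤ Real.log (Real.log T) := by
  have h1 : (1 : ℝ) < Real.log 3 := by exact_mod_cast one_lt_log_natCast (le_refl 3)
  exact Real.log_le_log (by linarith) (Real.log_le_log (by norm_num) (by exact_mod_cast hT))

theorem eventually_mul_explor_add_le {ε : ℝ} (hε : 0 < ε) (A : ℝ) :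
    ∀ᶠ T : ℕ in Filter.atTop, (1 + ε / 2) * explor T + A ≤ (1 + ε) * Real.log T := by
  have hlog : Filter.Tendsto (fun T : ℕ => Real.log T) Filter.atTop Filter.atTop :=
    Real.tendsto_log_atTop.comp tendsto_natCast_atTop_atTop
  have h1 := (Real.isLittleO_log_id_atTop.comp_tendsto hlog).bound
    (by positivity : 0 < ε / 4 / (3 * (1 + ε / 2)))
  filter_upwards [h1, hlog.eventually_ge_atTop (4 * A / ε), hlog.eventually_ge_atTop 0]
    with T h2 h3 h4
  simp only [Function.comp, id, Real.norm_eq_abs, abs_of_nonneg h4] at h2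
  have h5 := (le_abs_self _).trans h2
  have h6 : (1 + ε / 2) * (3 * Real.log (Real.log T)) ≤ ε / 4 * Real.log T := by
    calc (1 + ε / 2) * (3 * Real.log (Real.log T))
        ≤ (1 + ε / 2) * (3 * (ε / 4 / (3 * (1 + ε / 2)) * Real.log T)) := by gcongr
      _ = _ := by field_simp
  have h7 : A ≤ ε / 4 * Real.log T := by
    rw [div_le_iff₀ hε] at h3; linarith
  have h8 : (1 + ε / 2) * explor T =
      (1 + ε / 2) * Real.log T + (1 + ε / 2) * (3 * Real.log (Real.log T)) := by
    rw [explor]; ring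
  linarith

/-- The trivial bound of the regret, used for small `T`. -/
theorem regret_le_mul {C K : ℕ} {r : Fin K → ℝ} {θ : Fin C → Fin K → ℝ} {R : ℝ}
    (hr0 : ∀ k, 0 < r k) (hR : ∀ k, r k ≤ R) (hθ : ∀ c k, θ c k ∈ Set.Icc (0 : ℝ) 1)
    {cs : Fin C} {ks : Fin K} {Ω : Type*} [MeasurableSpace Ω] {P : Measure Ω}
    {sel : ℕ → Ω → Fin C × Fin K} (T : ℕ) : CRS.regret P r θ cs ks sel T ≤ R * T := by
  have h1 : CRS.thr r θ cs ks ≤ R :=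
    (mul_le_of_le_one_right (hr0 ks).le (hθ cs ks).2).trans (hR ks)
  have h2 : 0 ≤ ∑ c, ∑ k, CRS.thr r θ c k *
      ∫ ω, (CRS.pulls (fun n => sel n ω) T c k : ℝ) ∂P :=
    Finset.sum_nonneg fun c _ => Finset.sum_nonneg fun k _ =>
      mul_nonneg (mul_nonneg (hr0 k).le (hθ c k).1) (integral_nonneg fun _ => Nat.cast_nonneg _)
  have h3 := mul_le_mul_of_nonneg_right h1 (Nat.cast_nonneg (α := ℝ) T)
  unfold CRS.regret
  linarith

theorem theorem6 (C K : ℕ) (hK : 2 ≤ K) (r : Fin K → ℝ) (hr0 : ∀ k, 0 < r k) (hr : StrictMono r)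
    (ε : ℝ) (hε : 0 < ε) :
    ∃ Γ : ℝ, 0 < Γ ∧
      ∀ (θ : Fin C → Fin K → ℝ) (_ : ∀ c, θ c ∈ CRS.monotoneSet K ∩ CRS.unimodalSet r)
        (cs : Fin C) (ks : Fin K) (_ : CRS.IsBestPair r θ cs ks)
        (kb : Fin C → Fin K) (_ : ∀ c, CRS.IsBestRate r θ c (kb c)),
        CRS.crsConst r θ cs ks kb ≠ ⊤ ∧
        ∀ (Ω : Type*) [MeasurableSpace Ω] (P : Measure Ω) [IsProbabilityMeasure P]
          (X : Fin C → Fin K → ℕ → Ω → ℝ) (_ : CRS.IsOutcomeModel P θ X)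
          (sel : ℕ → Ω → Fin C × Fin K) (_ : ∀ n, Measurable (sel n))
          (_ : ∀ ω, CRS.IsCRST r (fun c k i => X c k i ω) (fun n => sel n ω))
          (T : ℕ) (_ : 3 ≤ T),
          CRS.regret P r θ cs ks sel T ≤
            (1 + ε) * (CRS.crsConst r θ cs ks kb).toReal * Real.log T +
              Γ * ((CRS.minGap r θ)⁻¹ ^ 2 + Real.log (Real.log T)) := by
  obtain ⟨l, hl0, hl1, hl⟩ := exists_isKLFraction (half_pos hε)
  set R := ∑ k, r k with hRdef
  have hR : ∀ k, r k ≤ R := fun k =>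
    Finset.single_le_sum (f := r) (fun k _ => (hr0 k).le) (Finset.mem_univ k)
  have hR0 : 0 < R := (hr0 ⟨0, by omega⟩).trans_le (hR _)
  -- from `T₀` on, the multiples of `crsConst` of lower order than `log T` are absorbed by `ε`
  obtain ⟨T₀, hT₀⟩ := Filter.eventually_atTop.1
    (eventually_mul_explor_add_le hε (C * K * (8 / l ^ 2)))
  have hL := log_log_three_pos
  have hL2 : Real.log (Real.log 2) < 0 := Real.log_neg (Real.log_pos (by norm_num))
    (by linarith [Real.log_two_lt_d9])
  -- `A₂`, `A₃` and `A₄` multiply `1`, `Δ⁻²` and `log log T` in the bound of the regret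
  set A₂ := R * (max (C * K) 3 : ℕ) + R * (C * K * (10 * Real.exp 1) * -Real.log (Real.log 2)) +
    C * K * (R * (K * 2) + R + (R + 4 / l ^ 2 * (3 * R))) with hA₂
  set A₃ := C * K * (R * (K * (40 * R ^ 2 / l ^ 2))) with hA₃
  set A₄ := R * (C * K * (10 * Real.exp 1)) with hA₄
  have hA₂0 : 0 ≤ A₂ := by
    have : 0 ≤ -Real.log (Real.log 2) := by linarith
    positivity
  have hA₃0 : 0 ≤ A₃ := by positivity
  have hA₄0 : 0 ≤ A₄ := by positivity
  have hB0 : 0 ≤ (A₂ + R * T₀) / Real.log (Real.log 3) := by positivity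
  -- `log log T ≥ log log 3 > 0`, so `log log T` also pays for the constant terms
  set Γ := 1 + A₃ + A₄ + (A₂ + R * T₀) / Real.log (Real.log 3) with hΓ
  refine ⟨Γ, by positivity, fun θ hθ cs ks hbest kb hkb => ?_⟩
  have hθu : ∀ c, θ c ∈ CRS.unimodalSet r := fun c => (hθ c).2
  refine ⟨crsConst_ne_top hK hr0 hθu hbest hkb, ?_⟩
  intro Ω _ P _ X hX sel hsel hcrs T hT
  have hLT := log_log_three_le hT
  have hΔ2 : 0 ≤ (CRS.minGap r θ)⁻¹ ^ 2 := sq_nonneg _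
  have hcrs0 : 0 ≤ (CRS.crsConst r θ cs ks kb).toReal := ENNReal.toReal_nonneg
  have hlogT := one_lt_log_natCast hT
  have hA : A₂ + R * T₀ ≤
      (A₂ + R * T₀) / Real.log (Real.log 3) * Real.log (Real.log T) := by
    rw [div_mul_eq_mul_div, le_div_iff₀ hL]
    exact mul_le_mul_of_nonneg_left hLT (by positivity)
  have hT₀0 : 0 ≤ R * (T₀ : ℝ) := by positivity
  have hΓsum : Γ * ((CRS.minGap r θ)⁻¹ ^ 2 + Real.log (Real.log T)) ≥
      A₃ * (CRS.minGap r θ)⁻¹ ^ 2 + A₄ * Real.log (Real.log T) + (A₂ + R * T₀) := by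
    have h1 : A₃ ≤ Γ := by linarith
    have h2 : A₄ + (A₂ + R * T₀) / Real.log (Real.log 3) ≤ Γ := by linarith
    have h3 := mul_le_mul_of_nonneg_right h1 hΔ2
    have h4 := mul_le_mul_of_nonneg_right h2 (hL.le.trans hLT)
    linarith
  have hΔterm : 0 ≤ A₃ * (CRS.minGap r θ)⁻¹ ^ 2 := mul_nonneg hA₃0 hΔ2
  have hLterm : 0 ≤ A₄ * Real.log (Real.log T) := mul_nonneg hA₄0 (hL.le.trans hLT)
  rcases lt_or_ge T T₀ with hsmall | hbig
  · have h1 := regret_le_mul (P := P) (sel := sel) (cs := cs) (ks := ks) hr0 hR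
      (fun c => (hθu c).1) T
    have h2 : R * (T : ℝ) ≤ R * T₀ :=
      mul_le_mul_of_nonneg_left (by exact_mod_cast hsmall.le) hR0.le
    have h3 : 0 ≤ (1 + ε) * (CRS.crsConst r θ cs ks kb).toReal * Real.log T := by positivity
    linarith
  · have h1 := regret_le (half_pos hε) hl hl0 hl1 hK hr0 hR hθu hbest hkb hX hsel hcrs hT
    have h2 := mul_le_mul_of_nonneg_right (hT₀ T hbig) hcrs0
    refine h1.trans ?_
    calc _ = ((1 + ε / 2) * explor T + C * K * (8 / l ^ 2)) *
            (CRS.crsConst r θ cs ks kb).toReal +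
          (A₃ * (CRS.minGap r θ)⁻¹ ^ 2 + A₄ * Real.log (Real.log T) + A₂) := by
          rw [hA₂, hA₃, hA₄]; ring
      _ ≤ (1 + ε) * Real.log T * (CRS.crsConst r θ cs ks kb).toReal +
          Γ * ((CRS.minGap r θ)⁻¹ ^ 2 + Real.log (Real.log T)) :=
          add_le_add h2 (by linarith)
      _ = _ := by ring
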